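/- For $p>1$, $r>-1$ let $$\psi_{p,r}(\sigma)=\frac{\Gamma((\sigma-1)p+r+1)}{\Gamma(\sigma)\,\Gamma((\sigma-1)(p-1)+r+1)},\qquad \Re\sigma>d_0:=1-\frac{1+r}{p},$$ and let $V_{p,r}$ be its inverse Mellin transform, $$V_{p,r}(x)=\lim_{T\to\infty}\frac1{2\pi i}\int_{d-iT}^{d+iT}x^{-\sigma}\psi_{p,r}(\sigma)\,d\sigma,\qquad d>d_0 .$$ Write $\binom an=a(a-1)\cdots(a-n+1)/n!$ for real $a$. Let $p=3/2$, $r\in\{-\tfrac12,0,\tfrac12\}$. For every $x\in(0,\sqrt{27/4})$ and every $d>d_0$ this limit exists, is a nonnegative real number and does not depend on $d$; moreover $V_{3/2,r}(x)\,dx$ on $(0,\sqrt{27/4})$ is the unique probability measure on $\mathbb R$ with moments $\binom{3n/2+r}{n}$, $n=0,1,2,\dots$. With $z=4x^2/27$ we have, for all $x\in(0,\sqrt{27/4})$, $$V_{3/2,-1/2}(x)=\frac{(1+\sqrt{1-z})^{2/3}}{3\pi\sqrt{3(1-z)}}z^{-1/3}+\frac{(1+\sqrt{1-z})^{-2/3}}{3\pi\sqrt{3(1-z)}}z^{1/3},$$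 $$V_{3/2,0}(x)=\frac{(1+\sqrt{1-z})^{1/3}}{3\pi\sqrt{1-z}}z^{-1/6}+\frac{(1+\sqrt{1-z})^{-1/3}}{3\pi\sqrt{1-z}}z^{1/6},$$ $$V_{3/2,1/2}(x)=\frac{(1+\sqrt{1-z})^{1/3}}{\pi\sqrt{3(1-z)}}z^{1/3}+\frac{(1+\sqrt{1-z})^{-1/3}}{\pi\sqrt{3(1-z)}}z^{2/3}.$$ Consequently, the sequence $\mathrm{A091527}(n)=\binom{3n/2-1/2}{n}4^n$ is the moment sequence of exactly one probability measure on $\mathbb R$, namely the one with density, on $(0,6\sqrt3)$, $$V(x)=\tfrac14V_{3/2,-1/2}(x/4)=\frac{x^{4/3}+9\cdot2^{4/3}\bigl(1+\sqrt{1-x^2/108}\bigr)^{4/3}}{2^{8/3}3^{5/2}\pi\,x^{2/3}\sqrt{1-x^2/108}\,\bigl(1+\sqrt{1-x^2/108}\bigr)^{2/3}},$$ and the sequence $$\mathrm{A061162}(n)=\mathrm{A091527}(2n)=\binom{3n-1/2}{2n}16^n=\frac{(6n)!\,n!}{(3n)!\,(2n)!^2}$$ is the moment sequence of exactly one probability measure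 on $\mathbb R$, namely the one with density, on $(0,108)$, $$\frac{V(\sqrt x)}{2\sqrt x}=\frac{x^{2/3}+9\cdot2^{4/3}\bigl(1+\sqrt{1-x/108}\bigr)^{4/3}}{2^{11/3}3^{5/2}\pi\,x^{5/6}\sqrt{1-x/108}\,\bigl(1+\sqrt{1-x/108}\bigr)^{2/3}}.$$ -/

import Mathlib

open MeasureTheory Set Filter Topology

noncomputable section

/-- The generalized binomial coefficient `binom(a, n) = a (a - 1) ⋯ (a - n + 1) / n!`
for real `a`. This is Mathlib's `Ring.choose`, see `realBinom_eq`. -/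
def realBinom (a : ℝ) (n : ℕ) : ℝ := Ring.choose a n

theorem realBinom_eq (a : ℝ) (n : ℕ) :
    realBinom a n = (∏ i ∈ Finset.range n, (a - (i : ℝ))) / (n.factorial : ℝ) := by
  rw [realBinom, Ring.choose_eq_smul, ← Polynomial.aeval_eq_smeval, Polynomial.aeval_def,
    Polynomial.eval₂_eq_eval_map, descPochhammer_map, descPochhammer_eval_eq_prod_range, smul_eq_mul, div_eq_inv_mul]

/-- The function
`ψ_{p,r}(σ) = Γ((σ - 1) p + r + 1) / (Γ(σ) Γ((σ - 1)(p - 1) + r + 1))`.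
It is used only for `p > 1`, `-1 < r` and `Re σ > 1 - (1 + r) / p`, where the numerator has no
pole. (If the argument of a Gamma function in the denominator is a pole, Mathlib's convention
`Γ = 0`, `w / 0 = 0` gives the correct value `0` of the reciprocal Gamma function.) -/
def psiFun (p r : ℝ) (σ : ℂ) : ℂ :=
  Complex.Gamma ((σ - 1) * (p : ℂ) + (r : ℂ) + 1) /
    (Complex.Gamma σ * Complex.Gamma ((σ - 1) * ((p : ℂ) - 1) + (r : ℂ) + 1))

/-- The truncated inverse Mellin integral
`(1 / (2 π i)) ∫_{d - i T}^{d + i T} x ^ (-σ) φ(σ) dσ`, parametrized by `σ = d + i t`, `|t| ≤ T`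
(so that `dσ = i dt`). -/
def mellinInvTrunc (φ : ℂ → ℂ) (d x T : ℝ) : ℂ :=
  (1 / (2 * (Real.pi : ℂ))) *
    ∫ t in (-T)..T,
      (x : ℂ) ^ (-((d : ℂ) + (t : ℂ) * Complex.I)) * φ ((d : ℂ) + (t : ℂ) * Complex.I)

/-- `V_{p,r}(x)`: the inverse Mellin transform of `ψ_{p,r}`, that is the limit of the truncated
integrals as `T → ∞` (the integrand is in general not absolutely integrable, so that the
improper integral is needed). The line of integration is `Re σ = d₀ + 1`, where
`d₀ = 1 - (1 + r) / p` is the abscissa to the right of which `ψ_{p,r}` is holomorphic. -/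
def binomialDensity (p r x : ℝ) : ℝ :=
  (limUnder atTop (fun T : ℝ => mellinInvTrunc (psiFun p r) (2 - (1 + r) / p) x T)).re

/-- `ν` is a probability measure on `ℝ`, all its moments are finite, and
`∫ x ^ n dν(x) = s n` for all `n = 0, 1, 2, …`. -/
def HasMomentSequence (ν : Measure ℝ) (s : ℕ → ℝ) : Prop :=
  IsProbabilityMeasure ν ∧
    ∀ n : ℕ, Integrable (fun x : ℝ => x ^ n) ν ∧ ∫ x, x ^ n ∂ν = s n

/-- The measure `f(x) dx` on the interval `(0, c)`, for `f ≥ 0` there. -/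
def densityMeasure (f : ℝ → ℝ) (c : ℝ) : Measure ℝ :=
  (volume.restrict (Ioo 0 c)).withDensity (fun x => ENNReal.ofReal (f x))

/-- OEIS A091527: `binom(3n/2 - 1/2, n) 4 ^ n`. -/
def seqA091527 (n : ℕ) : ℝ := realBinom (3 * (n : ℝ) / 2 - 1 / 2) n * 4 ^ n

/-- OEIS A061162: `(6n)! n! / ((3n)! (2n)! ^ 2)`. -/
def seqA061162 (n : ℕ) : ℝ :=
  (((6 * n).factorial : ℝ) * (n.factorial : ℝ)) /
    (((3 * n).factorial : ℝ) * ((2 * n).factorial : ℝ) ^ 2)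

end

/-! For p = 3/2 and r = 0 or -1/2, the numerator of ψ is Γ(3w) with w = (σ - a)/2, where a = 1/3 or
2/3 equals d₀. Gauss's multiplication formula (`Gamma_triplication`) splits Γ(3w) into Γ(w)Γ(w +
1/3)Γ(w + 2/3), and one of the last two factors cancels against the denominator of ψ. What remains
is an exponential in σ times the Beta function Γ((σ - a)/2)Γ((σ + a)/2)/Γ(σ).

The substitution w = 2√(x(1 - x)) folds the Beta integral at x = 1/2 and exhibits it as the Mellin
transform of the elementary function `halfAngleKernel a` on (0, 1); a dilation then moves the
support to (0, √(27/4)). The case r = 1/2 follows from r = 0, because ψ is shifted by one in σ and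
the density is therefore multiplied by x.

So each ψ is the Mellin transform of an explicit nonnegative function, differentiable inside its
support. Pointwise inversion (`tendsto_mellinInvTrunc`) identifies this function with V. Evaluating
the transform at σ = n + 1 gives the moments. Compact support bounds the even moments geometrically,
so the moments determine the characteristic function and hence the measure. The two integer
sequences come from dilating by 4 and from pushing forward under squaring. -/

/-! ### Determinacy of the moment problem -/

/-- The characteristic function of a measure with geometrically bounded even moments is the sum of
its moment series. -/
theorem hasSum_charFun_of_moments {ν : Measure ℝ} {s : ℕ → ℝ} (h : HasMomentSequence ν s) {C : ℝ}
    (hC : ∀ n, s (2 * n) ≤ C ^ n) (t : ℝ) :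
    HasSum (fun n : ℕ => ((t : ℂ) * Complex.I) ^ n / (n.factorial : ℂ) * (s n : ℂ))
      (charFun ν t) := by
  obtain ⟨hp, hm⟩ := h
  let F : ℕ → ℝ → ℂ := fun n x => ((t : ℂ) * Complex.I) ^ n / (n.factorial : ℂ) * ((x ^ n : ℝ) : ℂ)
  have hF : ∀ n, Integrable (F n) ν := fun n => ((hm n).1.ofReal).const_mul _
  -- Odd moments do not control absolute ones; |xⁿ| ≤ 1 + x²ⁿ reduces everything to even moments and
  -- leaves two exponential series as majorant.
  have hbound : ∀ n, ∫ x, ‖F n x‖ ∂ν ≤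
      |t| ^ n / n.factorial + (|t| * C) ^ n / n.factorial := by
    intro n
    have h1 : ∫ x, ‖F n x‖ ∂ν = |t| ^ n / n.factorial * ∫ x, |x ^ n| ∂ν := by
      rw [← integral_const_mul]
      congr 1
      ext x
      simp [F]
    have h2 : ∫ x, |x ^ n| ∂ν ≤ 1 + C ^ n := by
      calc ∫ x, |x ^ n| ∂ν ≤ ∫ x, (1 + x ^ (2 * n)) ∂ν := by
            refine integral_mono (hm n).1.abs ((integrable_const _).add (hm (2 * n)).1) fun x => ?_
            have : x ^ (2 * n) = |x ^ n| ^ 2 := by rw [sq_abs]; ring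
            simp only [this]
            nlinarith [sq_nonneg (|x ^ n| - 1)]
        _ = 1 + s (2 * n) := by
            rw [integral_add (integrable_const _) (hm (2 * n)).1, (hm (2 * n)).2]
            simp
        _ ≤ _ := by linarith [hC n]
    rw [h1]
    calc _ ≤ |t| ^ n / n.factorial * (1 + C ^ n) := by gcongr
      _ = _ := by rw [mul_pow]; ring
  have hsum : Summable fun n => ∫ x, ‖F n x‖ ∂ν :=
    Summable.of_nonneg_of_le (fun n => integral_nonneg fun x => norm_nonneg _) hbound
      ((Real.summable_pow_div_factorial _).add (Real.summable_pow_div_factorial _))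
  have key := hasSum_integral_of_summable_integral_norm hF hsum
  convert! key using 1
  · ext n
    simp only [F]
    rw [integral_const_mul, integral_complex_ofReal, (hm n).2]
  · rw [charFun_apply_real]
    congr 1
    ext x
    have := (NormedSpace.expSeries_div_hasSum_exp ((t : ℂ) * x * Complex.I)).tsum_eq
    rw [← Complex.exp_eq_exp_ℂ] at this
    rw [← this]
    congr 1
    ext n
    simp only [F]
    push_cast
    ring

/-- The moment problem with geometrically bounded even moments is determinate. -/
theorem HasMomentSequence.unique {μ ν : Measure ℝ} {s : ℕ → ℝ} (hμ : HasMomentSequence μ s)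
    (hν : HasMomentSequence ν s) {C : ℝ} (hC : ∀ n, s (2 * n) ≤ C ^ n) : ν = μ := by
  have := hμ.1
  have := hν.1
  refine Measure.ext_of_charFun (funext fun t => ?_)
  exact (hasSum_charFun_of_moments hν hC t).unique (hasSum_charFun_of_moments hμ hC t)

/-- A nonnegative density on a bounded interval is determined by its moments. -/
theorem hasMomentSequence_iff_eq_densityMeasure {f : ℝ → ℝ} {c : ℝ} {s : ℕ → ℝ}
    (hf0 : ∀ x ∈ Ioo 0 c, 0 ≤ f x)
    (hint : ∀ n : ℕ, IntegrableOn (fun x => x ^ n * f x) (Ioo 0 c))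
    (hs : ∀ n : ℕ, ∫ x in Ioo 0 c, x ^ n * f x = s n) (hs0 : s 0 = 1) (ν : Measure ℝ) :
    HasMomentSequence ν s ↔ ν = densityMeasure f c := by
  have hf : IntegrableOn f (Ioo 0 c) := by simpa using hint 0
  have hmeas : AEMeasurable (fun x => ENNReal.ofReal (f x)) (volume.restrict (Ioo 0 c)) :=
    hf.aemeasurable.ennreal_ofReal
  have hae : ∀ᵐ x ∂(volume.restrict (Ioo 0 c)), 0 ≤ f x := by
    filter_upwards [ae_restrict_mem measurableSet_Ioo] with x hx using hf0 x hx
  have hfin : ∀ᵐ x ∂(volume.restrict (Ioo 0 c)), ENNReal.ofReal (f x) < ⊤ :=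
    ae_of_all _ fun x => ENNReal.ofReal_lt_top
  have hmom : HasMomentSequence (densityMeasure f c) s := by
    refine ⟨⟨?_⟩, fun n => ⟨?_, ?_⟩⟩
    · rw [densityMeasure, withDensity_apply _ MeasurableSet.univ, Measure.restrict_univ,
        ← ofReal_integral_eq_lintegral_ofReal hf hae]
      have := hs 0
      simp only [pow_zero, one_mul] at this
      rw [this, hs0, ENNReal.ofReal_one]
    · rw [densityMeasure, integrable_withDensity_iff_integrable_smul₀' hmeas hfin]
      refine (hint n).congr ?_
      filter_upwards [hae] with x hx
      rw [ENNReal.toReal_ofReal hx, smul_eq_mul, mul_comm]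
    · rw [densityMeasure, integral_withDensity_eq_integral_toReal_smul₀ hmeas hfin, ← hs n]
      refine integral_congr_ae ?_
      filter_upwards [hae] with x hx
      rw [ENNReal.toReal_ofReal hx, smul_eq_mul, mul_comm]
  -- Support in (0, c) and total mass 1 bound the moment of order 2n by (c²)ⁿ.
  refine ⟨fun h => hmom.unique h (C := c ^ 2) fun n => ?_, fun h => h ▸ hmom⟩
  rw [← hs, ← pow_mul]
  calc ∫ x in Ioo 0 c, x ^ (2 * n) * f x ≤ ∫ x in Ioo 0 c, c ^ (2 * n) * f x := by
        refine setIntegral_mono_on (hint _) (hf.const_mul _) measurableSet_Ioo fun x hx => ?_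
        exact mul_le_mul_of_nonneg_right (pow_le_pow_left₀ hx.1.le hx.2.le _) (hf0 x hx)
    _ = c ^ (2 * n) := by
        have := hs 0
        simp only [pow_zero, one_mul] at this
        rw [integral_const_mul, this, hs0, mul_one]

/-! ### Pointwise Fourier and Mellin inversion -/

open scoped FourierTransform

/-- An integrable function vanishing at a point of differentiability `y` is `(u - y) q(u)` with `q`
integrable. -/
theorem integrable_div_sub {k : ℝ → ℂ} (hk : Integrable k) {y : ℝ} (hd : DifferentiableAt ℝ k y)
    (h0 : k y = 0) : Integrable (fun u : ℝ => k u / ((u : ℂ) - y)) := by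
  have hmeas : AEStronglyMeasurable (fun u : ℝ => k u / ((u : ℂ) - y)) volume := by
    simp only [div_eq_mul_inv]
    refine hk.aestronglyMeasurable.mul (Measurable.aestronglyMeasurable ?_)
    fun_prop
  -- Near y differentiability bounds the quotient by a constant; at distance at least δ it is at
  -- most ‖k‖/δ. The sum of the two bounds is an integrable majorant.
  have hO : (fun u => k u) =O[𝓝 y] fun u => u - y := by
    simpa [h0] using hd.isBigO_sub
  obtain ⟨C, hC⟩ := hO.bound
  obtain ⟨δ, hδ, hball⟩ := Metric.eventually_nhds_iff.1 hC
  have hb1 : Integrable (indicator (Metric.ball y δ) fun _ : ℝ => |C|) :=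
    (integrable_indicator_iff measurableSet_ball).2 (integrableOn_const (by simp [ENNReal.mul_eq_top]))
  refine Integrable.mono' (hb1.add (hk.norm.const_mul δ⁻¹)) hmeas (ae_of_all _ fun u => ?_)
  have hnorm : ‖k u / ((u : ℂ) - y)‖ = ‖k u‖ / |u - y| := by
    rw [norm_div, ← Complex.ofReal_sub, Complex.norm_real, Real.norm_eq_abs]
  rw [hnorm]
  simp only [Pi.add_apply]
  by_cases hu : u ∈ Metric.ball y δ
  · rw [indicator_of_mem hu]
    have h1 := hball hu
    rw [Real.norm_eq_abs] at h1
    have h2 : ‖k u‖ / |u - y| ≤ |C| := by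
      refine div_le_of_le_mul₀ (abs_nonneg _) (abs_nonneg _) (h1.trans ?_)
      gcongr
      exact le_abs_self C
    have : 0 ≤ δ⁻¹ * ‖k u‖ := by positivity
    linarith
  · rw [indicator_of_notMem hu, zero_add, div_eq_inv_mul]
    have : δ ≤ |u - y| := by simpa [Real.dist_eq] using hu
    gcongr

theorem continuous_fourier {f : ℝ → ℂ} (hf : Integrable f) : Continuous (𝓕 f) :=
  VectorFourier.fourierIntegral_continuous Real.continuous_fourierChar (by fun_prop) hf

/-- The truncated inverse Fourier integral at `y` of `(u - y) q(u)` tends to `0`. -/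
theorem tendsto_truncated_fourierInv_zero {q : ℝ → ℂ} (hq : Integrable q) {y : ℝ}
    (hk : Integrable fun u : ℝ => ((u : ℂ) - y) * q u) :
    Tendsto (fun T : ℝ => ∫ ξ in (-T)..T, Complex.exp (2 * Real.pi * Complex.I * y * ξ) *
      𝓕 (fun u : ℝ => ((u : ℂ) - y) * q u) ξ) atTop (𝓝 0) := by
  set k : ℝ → ℂ := fun u : ℝ => ((u : ℂ) - y) * q u with hkdef
  set E : ℝ → ℂ := fun ξ => Complex.exp (2 * Real.pi * Complex.I * y * ξ) with hE
  have hq' : Integrable (fun u : ℝ => u • q u) := by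
    refine (hk.add (hq.const_mul (y : ℂ))).congr (ae_of_all _ fun u => ?_)
    simp [hkdef]
    ring
  have hfun : ∀ ξ, 𝓕 (fun x : ℝ => (-2 * Real.pi * Complex.I * x) • q x) ξ =
      -2 * Real.pi * Complex.I * (𝓕 k ξ + y * 𝓕 q ξ) := by
    intro ξ
    simp only [Real.fourier_eq, smul_eq_mul]
    rw [← integral_const_mul, ← integral_add, ← integral_const_mul]
    · congr 1
      ext u
      simp only [hkdef, Circle.smul_def, smul_eq_mul]
      ring
    · exact (Real.fourierIntegral_convergent_iff ξ).2 hk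
    · exact ((Real.fourierIntegral_convergent_iff ξ).2 hq).const_mul _
  have hEd : ∀ ξ : ℝ, HasDerivAt E (2 * Real.pi * Complex.I * y * E ξ) ξ := by
    intro ξ
    have h1 : HasDerivAt (fun ξ : ℝ => 2 * Real.pi * Complex.I * y * (ξ : ℂ))
        (2 * Real.pi * Complex.I * y) ξ := by
      simpa using (Complex.ofRealCLM.hasDerivAt (x := ξ)).const_mul (2 * Real.pi * Complex.I * y : ℂ)
    simpa [hE, mul_comm] using h1.cexp
  -- Multiplication by u - y becomes an exact derivative after the phase is included: the term y 𝓕 q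
  -- from differentiating the exponential cancels the one in `hfun`. The truncated integral is thus
  -- two boundary values, which vanish in the limit by Riemann–Lebesgue.
  have hG : ∀ ξ : ℝ, HasDerivAt (fun ξ => E ξ * 𝓕 q ξ / (-2 * Real.pi * Complex.I))
      (E ξ * 𝓕 k ξ) ξ := by
    intro ξ
    have := ((hEd ξ).mul (Real.hasDerivAt_fourier hq hq' ξ)).div_const (-2 * Real.pi * Complex.I)
    convert! this using 1
    rw [hfun]
    have : (Real.pi : ℂ) ≠ 0 := by exact_mod_cast Real.pi_ne_zero
    field_simp
    ring
  have hEc : Continuous E := by fun_prop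
  have hFTC : ∀ T : ℝ, ∫ ξ in (-T)..T, E ξ * 𝓕 k ξ =
      E T * 𝓕 q T / (-2 * Real.pi * Complex.I) - E (-T) * 𝓕 q (-T) / (-2 * Real.pi * Complex.I) :=
    fun T => intervalIntegral.integral_eq_sub_of_hasDerivAt (fun ξ _ => hG ξ)
      ((hEc.mul (continuous_fourier hk)).intervalIntegrable _ _)
  have hEn : ∀ ξ, ‖E ξ‖ = 1 := by
    intro ξ
    simp only [hE]
    rw [show (2 * Real.pi * Complex.I * y * ξ : ℂ) = ((2 * Real.pi * y * ξ : ℝ) : ℂ) * Complex.I by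
      push_cast; ring]
    exact Complex.norm_exp_ofReal_mul_I _
  have hlim : Tendsto (fun ξ => E ξ * 𝓕 q ξ / (-2 * Real.pi * Complex.I)) (cocompact ℝ) (𝓝 0) := by
    rw [← zero_div (-2 * Real.pi * Complex.I : ℂ)]
    refine Tendsto.div_const ?_ _
    rw [tendsto_zero_iff_norm_tendsto_zero]
    simpa [hEn] using (Real.zero_at_infty_fourier q).norm
  have h1 := hlim.mono_left atTop_le_cocompact
  have h2 := (hlim.mono_left atBot_le_cocompact).comp tendsto_neg_atTop_atBot
  have := h1.sub h2
  rw [sub_zero] at this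
  refine this.congr fun T => ?_
  rw [hFTC]
  rfl

theorem integrable_gaussian_complex (y : ℝ) :
    Integrable fun u : ℝ => Complex.exp (-Real.pi * ((u : ℂ) - y) ^ 2) := by
  have h := (integrable_cexp_neg_mul_sq (b := (Real.pi : ℂ)) (by simpa using Real.pi_pos)).comp_sub_right y
  simpa using h

theorem fourier_shifted_gaussian (y ξ : ℝ) :
    𝓕 (fun u : ℝ => Complex.exp (-Real.pi * ((u : ℂ) - y) ^ 2)) ξ =
      Complex.exp (-(2 * Real.pi * Complex.I * y * ξ)) * Complex.exp (-Real.pi * (ξ : ℂ) ^ 2) := by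
  have h := congrFun (fourier_gaussian_pi' (b := 1) (by simp) (y : ℂ)) ξ
  have hfun : (fun u : ℝ => Complex.exp (-Real.pi * ((u : ℂ) - y) ^ 2)) =
      fun u : ℝ => Complex.exp (-Real.pi * (y : ℂ) ^ 2) *
        Complex.exp (-Real.pi * 1 * (u : ℂ) ^ 2 + 2 * Real.pi * y * u) := by
    ext u
    rw [← Complex.exp_add]
    ring_nf
  have hc : 𝓕 (fun u : ℝ => Complex.exp (-Real.pi * (y : ℂ) ^ 2) *
        Complex.exp (-Real.pi * 1 * (u : ℂ) ^ 2 + 2 * Real.pi * y * u)) ξ =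
      Complex.exp (-Real.pi * (y : ℂ) ^ 2) *
        𝓕 (fun u : ℝ => Complex.exp (-Real.pi * 1 * (u : ℂ) ^ 2 + 2 * Real.pi * y * u)) ξ := by
    simp only [Real.fourier_eq]
    rw [← integral_const_mul]
    congr 1
    ext u
    simp only [Circle.smul_def, smul_eq_mul]
    ring
  rw [hfun, hc, h]
  simp only [Complex.one_cpow, div_one, one_mul]
  rw [← Complex.exp_add, ← Complex.exp_add]
  congr 1
  ring_nf
  simp only [Complex.I_sq]
  ring

/-- **Pointwise Fourier inversion** at a point of differentiability of an integrable function, as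
an improper integral. -/
theorem tendsto_truncated_fourierInv {g : ℝ → ℂ} (hg : Integrable g) {y : ℝ}
    (hd : DifferentiableAt ℝ g y) :
    Tendsto (fun T : ℝ => ∫ ξ in (-T)..T, Complex.exp (2 * Real.pi * Complex.I * y * ξ) * 𝓕 g ξ)
      atTop (𝓝 (g y)) := by
  -- The Gaussian centred at y has value 1 there, and its inversion integral is known exactly.
  -- Subtracting g(y)γ leaves a function vanishing at y, to which the previous case applies.
  set γ : ℝ → ℂ := fun u => Complex.exp (-Real.pi * ((u : ℂ) - y) ^ 2) with hγ
  have hγi : Integrable γ := integrable_gaussian_complex y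
  have hγd : DifferentiableAt ℝ γ y := by
    have : DifferentiableAt ℝ (fun u : ℝ => (u : ℂ)) y := Complex.ofRealCLM.differentiableAt
    simp only [hγ]
    fun_prop
  have hγy : γ y = 1 := by simp [hγ]
  set k : ℝ → ℂ := fun u => g u - g y * γ u with hk
  have hki : Integrable k := hg.sub (hγi.const_mul _)
  have hkd : DifferentiableAt ℝ k y := hd.sub (hγd.const_mul _)
  have hky : k y = 0 := by simp [hk, hγy]
  have hkq : k = fun u : ℝ => ((u : ℂ) - y) * (k u / ((u : ℂ) - y)) := by
    ext u
    by_cases hu : u = y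
    · simp [hu, hky]
    · have : (u : ℂ) - y ≠ 0 := by rw [sub_ne_zero]; exact_mod_cast hu
      field_simp
  have h0 := tendsto_truncated_fourierInv_zero (integrable_div_sub hki hkd hky)
    (y := y) (by rw [← hkq]; exact hki)
  rw [← hkq] at h0
  have hE : ∀ ξ : ℝ, Complex.exp (2 * Real.pi * Complex.I * y * ξ) * 𝓕 g ξ =
      Complex.exp (2 * Real.pi * Complex.I * y * ξ) * 𝓕 k ξ +
        g y * Complex.exp (-Real.pi * (ξ : ℂ) ^ 2) := by
    intro ξ
    have h1 : 𝓕 g ξ = 𝓕 k ξ + g y * 𝓕 γ ξ := by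
      simp only [Real.fourier_eq]
      rw [← integral_const_mul, ← integral_add]
      · congr 1
        ext u
        simp only [hk, Circle.smul_def, smul_eq_mul]
        ring
      · exact (Real.fourierIntegral_convergent_iff ξ).2 hki
      · exact ((Real.fourierIntegral_convergent_iff ξ).2 hγi).const_mul _
    rw [h1, hγ, fourier_shifted_gaussian, Complex.exp_neg]
    have := Complex.exp_ne_zero (2 * Real.pi * Complex.I * y * ξ)
    field_simp
  have hgauss : Integrable fun ξ : ℝ => Complex.exp (-Real.pi * (ξ : ℂ) ^ 2) := by
    simpa using integrable_gaussian_complex 0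
  have hgint : ∫ ξ : ℝ, Complex.exp (-Real.pi * (ξ : ℂ) ^ 2) = 1 := by
    have := integral_gaussian_complex (b := (Real.pi : ℂ)) (by simpa using Real.pi_pos)
    rw [this, div_self (by exact_mod_cast Real.pi_ne_zero), Complex.one_cpow]
  have h2 := (intervalIntegral_tendsto_integral hgauss tendsto_neg_atTop_atBot
    tendsto_id).const_mul (g y)
  have h3 := h0.add h2
  rw [hgint, zero_add, mul_one] at h3
  refine h3.congr fun T => ?_
  simp only [hE]
  rw [intervalIntegral.integral_add, intervalIntegral.integral_const_mul]
  · rfl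
  · exact (Continuous.mul (by fun_prop) (continuous_fourier hki)).intervalIntegrable _ _
  · exact Continuous.intervalIntegrable (by fun_prop) _ _

/-- **Pointwise Mellin inversion** along a vertical line, as an improper integral. -/
theorem tendsto_mellinInvTrunc {f : ℝ → ℂ} {φ : ℂ → ℂ} {d x : ℝ} (hx : 0 < x)
    (hf : MellinConvergent f d) (hd : DifferentiableAt ℝ f x)
    (hφ : ∀ t : ℝ, φ ((d : ℂ) + t * Complex.I) = mellin f ((d : ℂ) + t * Complex.I)) :
    Tendsto (fun T : ℝ => mellinInvTrunc φ d x T) atTop (𝓝 (f x)) := by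
  -- The substitution x = exp(-u) turns the Mellin transform on Re σ = d into the Fourier transform
  -- of g at frequency t/(2π), whence the rescaling of T below.
  set g : ℝ → ℂ := fun u => Real.exp (-d * u) • f (Real.exp (-u)) with hg
  have hgi : Integrable g := by
    have h1 := hf
    rw [MellinConvergent] at h1
    have himg : Ioi (0 : ℝ) = (fun u => Real.exp (-u)) '' univ := by
      rw [image_univ]
      ext z
      simp only [mem_Ioi, mem_range]
      exact ⟨fun hz => ⟨-Real.log z, by rw [neg_neg, Real.exp_log hz]⟩,
        fun ⟨u, hu⟩ => hu ▸ Real.exp_pos _⟩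
    rw [himg, integrableOn_image_iff_integrableOn_abs_deriv_smul MeasurableSet.univ
      (f' := fun u => -Real.exp (-u))
      (fun u _ => by simpa using ((hasDerivAt_neg u).exp).hasDerivWithinAt (s := univ))
      (fun a _ b _ h => by simpa using Real.exp_injective h), integrableOn_univ] at h1
    refine h1.congr (ae_of_all _ fun u => ?_)
    simp only [hg, abs_neg, abs_of_pos (Real.exp_pos _)]
    rw [← Complex.ofReal_one, ← Complex.ofReal_sub, ← Complex.ofReal_cpow (Real.exp_pos _).le,
      Complex.coe_smul, smul_smul, ← Real.exp_mul, ← Real.exp_add]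
    congr 2
    ring
  set y : ℝ := -Real.log x with hy
  have hxy : Real.exp (-y) = x := by rw [hy, neg_neg, Real.exp_log hx]
  have hgd : DifferentiableAt ℝ g y := by
    have h1 : DifferentiableAt ℝ (fun u => f (Real.exp (-u))) y := by
      refine DifferentiableAt.comp (g := f) y ?_ (by fun_prop)
      rw [hxy]; exact hd
    have h2 : DifferentiableAt ℝ (fun u : ℝ => Real.exp (-d * u)) y := by fun_prop
    exact h2.smul h1
  have hgy : ((x ^ (-d) : ℝ) : ℂ) * g y = f x := by
    simp only [hg]
    rw [hxy, Complex.real_smul, ← mul_assoc, ← Complex.ofReal_mul]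
    rw [Real.rpow_def_of_pos hx, ← Real.exp_add, hy]
    ring_nf
    simp
  have key := (tendsto_truncated_fourierInv hgi hgd).const_mul ((x ^ (-d) : ℝ) : ℂ)
  rw [hgy] at key
  have h2π : (0 : ℝ) < 2 * Real.pi := by positivity
  have hscale : Tendsto (fun T : ℝ => T / (2 * Real.pi)) atTop atTop :=
    tendsto_id.atTop_div_const h2π
  refine (key.comp hscale).congr fun T => ?_
  simp only [Function.comp, mellinInvTrunc]
  have hint : ∀ t : ℝ, (x : ℂ) ^ (-((d : ℂ) + (t : ℂ) * Complex.I)) *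
      φ ((d : ℂ) + (t : ℂ) * Complex.I) =
      ((x ^ (-d) : ℝ) : ℂ) * (fun ξ : ℝ => Complex.exp (2 * Real.pi * Complex.I * y * ξ) * 𝓕 g ξ)
        (t / (2 * Real.pi)) := by
    intro t
    have hre : ((d : ℂ) + t * Complex.I).re = d := by simp
    have him : ((d : ℂ) + t * Complex.I).im = t := by simp
    rw [hφ, mellin_eq_fourier, hre, him]
    simp only []
    rw [← mul_assoc]
    congr 1
    have hx0 : (x : ℂ) ≠ 0 := by exact_mod_cast hx.ne'
    rw [neg_add, Complex.cpow_add _ _ hx0, Complex.ofReal_cpow hx.le, Complex.ofReal_neg]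
    congr 1
    rw [Complex.cpow_def_of_ne_zero hx0, ← Complex.ofReal_log hx.le, hy]
    congr 1
    have : (Real.pi : ℂ) ≠ 0 := by exact_mod_cast Real.pi_ne_zero
    push_cast
    field_simp
  simp only [hint]
  rw [intervalIntegral.integral_const_mul, intervalIntegral.integral_comp_div
    (fun ξ : ℝ => Complex.exp (2 * Real.pi * Complex.I * y * ξ) * 𝓕 g ξ) h2π.ne', neg_div,
    Complex.real_smul]
  push_cast
  have : (Real.pi : ℂ) ≠ 0 := by exact_mod_cast Real.pi_ne_zero
  field_simp

/-! ### Gauss multiplication formula for the factor three -/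

theorem prod_range_three_mul {M : Type*} [CommMonoid M] (f : ℕ → M) (n : ℕ) :
    ∏ j ∈ Finset.range (3 * n), f j =
      ∏ j ∈ Finset.range n, (f (3 * j) * f (3 * j + 1) * f (3 * j + 2)) := by
  induction n with
  | zero => simp
  | succ n ih =>
    rw [Finset.prod_range_succ, ← ih, show 3 * (n + 1) = 3 * n + 1 + 1 + 1 by ring,
      Finset.prod_range_succ, Finset.prod_range_succ, Finset.prod_range_succ]
    simp only [mul_assoc]

/-- The three Euler products, of n + 1 factors each, interleave to the 3n + 3 factors for 3w, which
is why the index there is 3n + 2. The last factor on the right does not depend on w; this is what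
makes its limit computable. -/
theorem GammaSeq_triple (w : ℂ) (hw : 0 < w.re) {n : ℕ} (hn : n ≠ 0) :
    Complex.GammaSeq w n * Complex.GammaSeq (w + 1 / 3) n * Complex.GammaSeq (w + 2 / 3) n =
      Complex.GammaSeq (3 * w) (3 * n + 2) * ((n : ℂ) / (3 * n + 2 : ℕ)) ^ (3 * w) *
        (3 ^ (3 * n + 3) * n * (n.factorial : ℂ) ^ 3 / ((3 * n + 2).factorial : ℂ)) := by
  have hn0 : (n : ℂ) ≠ 0 := by exact_mod_cast hn
  have hm0 : ((3 * n + 2 : ℕ) : ℂ) ≠ 0 := by exact_mod_cast (by omega : 3 * n + 2 ≠ 0)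
  have hne : ∀ (r : ℝ) , 0 ≤ r → w + r ≠ 0 := by
    intro r hr h
    have := congrArg Complex.re h
    simp at this
    linarith
  have hprod : ∏ j ∈ Finset.range (3 * n + 2 + 1), (3 * w + (j : ℂ)) =
      3 ^ (3 * (n + 1)) * ((∏ j ∈ Finset.range (n + 1), (w + j)) *
        (∏ j ∈ Finset.range (n + 1), (w + 1 / 3 + j)) *
        ∏ j ∈ Finset.range (n + 1), (w + 2 / 3 + j)) := by
    rw [show 3 * n + 2 + 1 = 3 * (n + 1) by ring, prod_range_three_mul,
      pow_mul, ← Finset.prod_mul_distrib,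
      ← Finset.prod_mul_distrib, ← Finset.card_range (n + 1), ← Finset.prod_const,
      Finset.card_range, ← Finset.prod_mul_distrib]
    refine Finset.prod_congr rfl fun j _ => ?_
    push_cast
    ring
  have h1 : ∏ j ∈ Finset.range (n + 1), (w + j) ≠ 0 :=
    Finset.prod_ne_zero_iff.2 fun j _ => by simpa using hne j (by positivity)
  have h2 : ∏ j ∈ Finset.range (n + 1), (w + 1 / 3 + j) ≠ 0 :=
    Finset.prod_ne_zero_iff.2 fun j _ => by
      simpa [add_assoc] using hne (1 / 3 + j) (by positivity)
  have h3 : ∏ j ∈ Finset.range (n + 1), (w + 2 / 3 + j) ≠ 0 :=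
    Finset.prod_ne_zero_iff.2 fun j _ => by
      simpa [add_assoc] using hne (2 / 3 + j) (by positivity)
  have hf : ((3 * n + 2).factorial : ℂ) ≠ 0 := by exact_mod_cast Nat.factorial_ne_zero _
  have hdiv : ((n : ℂ) / (3 * n + 2 : ℕ)) ^ (3 * w) = (n : ℂ) ^ (3 * w) /
      ((3 * n + 2 : ℕ) : ℂ) ^ (3 * w) := by
    have hmp : ((3 * n + 2 : ℕ) : ℂ) ^ (3 * w) ≠ 0 := by
      simp only [ne_eq, Complex.cpow_eq_zero_iff, hm0, false_and, not_false_eq_true]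
    have h := Complex.mul_cpow_ofReal_nonneg (a := (n : ℝ) / (3 * n + 2 : ℕ))
      (b := ((3 * n + 2 : ℕ) : ℝ)) (by positivity) (by positivity) (3 * w)
    rw [← Complex.ofReal_mul, div_mul_cancel₀ _ (by positivity), Complex.ofReal_div,
      Complex.ofReal_natCast, Complex.ofReal_natCast] at h
    rw [h, mul_div_cancel_right₀ _ hmp]
  have hpow : (n : ℂ) ^ w * (n : ℂ) ^ (w + 1 / 3) * (n : ℂ) ^ (w + 2 / 3) =
      (n : ℂ) ^ (3 * w) * n := by
    rw [← Complex.cpow_add _ _ hn0, ← Complex.cpow_add _ _ hn0]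
    rw [show w + (w + 1 / 3) + (w + 2 / 3) = 3 * w + 1 by ring, Complex.cpow_add _ _ hn0,
      Complex.cpow_one]
  have hmp : ((3 * n + 2 : ℕ) : ℂ) ^ (3 * w) ≠ 0 := by
    simp only [ne_eq, Complex.cpow_eq_zero_iff, hm0, false_and, not_false_eq_true]
  simp only [Complex.GammaSeq]
  rw [hprod, hdiv]
  rw [div_mul_div_comm, div_mul_div_comm, show 3 * n + 3 = 3 * (n + 1) by ring]
  generalize ∏ j ∈ Finset.range (n + 1), (w + j) = A at h1 ⊢
  generalize ∏ j ∈ Finset.range (n + 1), (w + 1 / 3 + j) = B at h2 ⊢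
  generalize ∏ j ∈ Finset.range (n + 1), (w + 2 / 3 + j) = D at h3 ⊢
  generalize (n : ℂ) ^ w = a, (n : ℂ) ^ (w + 1 / 3) = b, (n : ℂ) ^ (w + 2 / 3) = c,
    (n : ℂ) ^ (3 * w) = e at hpow ⊢
  generalize ((3 * n + 2 : ℕ) : ℂ) ^ (3 * w) = m at hmp ⊢
  generalize ((3 * n + 2).factorial : ℂ) = F at hf ⊢
  field_simp
  linear_combination (n.factorial : ℂ) ^ 3 * hpow

theorem Gamma_one_third_mul_Gamma_two_thirds :
    Complex.Gamma (1 / 3) * Complex.Gamma (2 / 3) = ((2 * Real.pi / √3 : ℝ) : ℂ) := by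
  have h := Real.Gamma_mul_Gamma_one_sub (1 / 3)
  rw [show Real.pi * (1 / 3) = Real.pi / 3 by ring, Real.sin_pi_div_three,
    show (1 - 1 / 3 : ℝ) = 2 / 3 by norm_num] at h
  have h2 := congrArg (fun t : ℝ => (t : ℂ)) h
  simp only [Complex.ofReal_mul, ← Complex.Gamma_ofReal] at h2
  push_cast at h2
  rw [h2]
  push_cast
  field_simp

/-- **Gauss multiplication formula** for the factor three on the right half plane. -/
theorem Gamma_triplication {w : ℂ} (hw : 0 < w.re) :
    Complex.Gamma w * Complex.Gamma (w + 1 / 3) * Complex.Gamma (w + 2 / 3) =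
      Complex.Gamma (3 * w) * (1 / 3) ^ (3 * w) * ((2 * Real.pi * √3 : ℝ) : ℂ) := by
  have hsub : Tendsto (fun n : ℕ => 3 * n + 2) atTop atTop :=
    tendsto_atTop_mono (fun n => by simp only [id]; omega) tendsto_id
  have hratio : Tendsto (fun n : ℕ => (n : ℂ) / (3 * n + 2 : ℕ)) atTop (𝓝 (1 / 3)) := by
    have h1 : Tendsto (fun n : ℕ => 1 / (3 + 2 * (n : ℂ)⁻¹)) atTop (𝓝 (1 / (3 + 2 * 0))) := by
      refine Tendsto.div tendsto_const_nhds ?_ (by norm_num)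
      exact tendsto_const_nhds.add (tendsto_inv_atTop_nhds_zero_nat.const_mul 2)
    rw [mul_zero, add_zero] at h1
    refine h1.congr' ?_
    filter_upwards [eventually_ne_atTop 0] with n hn
    have hn0 : (n : ℂ) ≠ 0 := by exact_mod_cast hn
    have : (3 * (n : ℂ) + 2) ≠ 0 := by
      have : ((3 * n + 2 : ℕ) : ℂ) ≠ 0 := by exact_mod_cast (by omega : 3 * n + 2 ≠ 0)
      exact_mod_cast this
    push_cast
    field_simp
  have hleft : ∀ v : ℂ, Tendsto (fun n => Complex.GammaSeq v n * Complex.GammaSeq (v + 1 / 3) n *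
      Complex.GammaSeq (v + 2 / 3) n) atTop
      (𝓝 (Complex.Gamma v * Complex.Gamma (v + 1 / 3) * Complex.Gamma (v + 2 / 3))) := fun v =>
    ((Complex.GammaSeq_tendsto_Gamma v).mul (Complex.GammaSeq_tendsto_Gamma _)).mul
      (Complex.GammaSeq_tendsto_Gamma _)
  have hright : ∀ v : ℂ, Tendsto (fun n : ℕ => Complex.GammaSeq (3 * v) (3 * n + 2) *
      ((n : ℂ) / (3 * n + 2 : ℕ)) ^ (3 * v)) atTop
      (𝓝 (Complex.Gamma (3 * v) * (1 / 3) ^ (3 * v))) := fun v =>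
    ((Complex.GammaSeq_tendsto_Gamma _).comp hsub).mul
      (hratio.cpow tendsto_const_nhds (by left; norm_num))
  have h13 : (1 / 3 : ℂ) ≠ 0 := by norm_num
  -- No Stirling asymptotics are needed: the factor is independent of w, so its limit is read off at
  -- w = 1/3, where Γ(1/3)Γ(2/3)Γ(1) is known from the reflection formula.
  have hconst : Tendsto (fun n : ℕ => (3 : ℂ) ^ (3 * n + 3) * n * (n.factorial : ℂ) ^ 3 /
      ((3 * n + 2).factorial : ℂ)) atTop (𝓝 ((2 * Real.pi * √3 : ℝ) : ℂ)) := by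
    have hR := hright (1 / 3)
    have hval : Complex.Gamma (3 * (1 / 3)) * (1 / 3 : ℂ) ^ (3 * (1 / 3) : ℂ) = 1 / 3 := by
      rw [show (3 * (1 / 3) : ℂ) = 1 by norm_num, Complex.Gamma_one, Complex.cpow_one, one_mul]
    rw [hval] at hR
    have h := (hleft (1 / 3)).div hR h13
    have hlim : Complex.Gamma (1 / 3) * Complex.Gamma (1 / 3 + 1 / 3) *
        Complex.Gamma (1 / 3 + 2 / 3) / (1 / 3) = ((2 * Real.pi * √3 : ℝ) : ℂ) := by
      rw [show (1 / 3 + 1 / 3 : ℂ) = 2 / 3 by norm_num, show (1 / 3 + 2 / 3 : ℂ) = 1 by norm_num,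
        Gamma_one_third_mul_Gamma_two_thirds, Complex.Gamma_one, mul_one]
      have : 2 * Real.pi / √3 * 3 = 2 * Real.pi * √3 := by
        have h3 : √3 * √3 = 3 := Real.mul_self_sqrt (by norm_num)
        have : √3 ≠ 0 := by positivity
        field_simp
        linear_combination -h3
      rw [← this]
      push_cast
      ring
    rw [hlim] at h
    refine h.congr' ?_
    filter_upwards [eventually_ne_atTop 0, hR.eventually_ne h13] with n hn hne
    simp only [Pi.div_apply]
    rw [GammaSeq_triple _ (by norm_num) hn, mul_div_cancel_left₀ _ hne]
  refine tendsto_nhds_unique (hleft w) (((hright w).mul hconst).congr' ?_)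
  filter_upwards [eventually_ne_atTop 0] with n hn
  rw [GammaSeq_triple w hw hn]

/-! ### The half-angle kernel and its Mellin transform -/

noncomputable section

/-- In the coordinate `w = sin φ`, the function
`(cot (φ / 2) ^ a + tan (φ / 2) ^ a) / cos φ` on `0 < φ < π / 2`. -/
def halfAngleKernel (a w : ℝ) : ℝ :=
  (((1 + √(1 - w ^ 2)) / w) ^ a + ((1 + √(1 - w ^ 2)) / w) ^ (-a)) / √(1 - w ^ 2)

theorem halfAngleKernel_nonneg (a : ℝ) {w : ℝ} (hw : 0 < w) : 0 ≤ halfAngleKernel a w := by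
  have : 0 < (1 + √(1 - w ^ 2)) / w := by positivity
  unfold halfAngleKernel
  positivity

theorem differentiableAt_halfAngleKernel (a : ℝ) {w : ℝ} (hw : w ∈ Ioo (0 : ℝ) 1) :
    DifferentiableAt ℝ (halfAngleKernel a) w := by
  have h1 : 1 - w ^ 2 ≠ 0 := by nlinarith [hw.1, hw.2]
  have h2 : 0 < 1 - w ^ 2 := by nlinarith [hw.1, hw.2]
  have hs : DifferentiableAt ℝ (fun w : ℝ => √(1 - w ^ 2)) w :=
    DifferentiableAt.sqrt (by fun_prop) h1
  have hu : DifferentiableAt ℝ (fun w : ℝ => (1 + √(1 - w ^ 2)) / w) w :=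
    (hs.const_add 1).div differentiableAt_id hw.1.ne'
  have hu0 : (1 + √(1 - w ^ 2)) / w ≠ 0 := by
    have := hw.1
    positivity
  exact ((hu.rpow_const (Or.inl hu0)).add (hu.rpow_const (Or.inl hu0))).div hs
    (Real.sqrt_pos.2 h2).ne'

theorem image_two_mul_sqrt :
    (fun x : ℝ => 2 * √(x * (1 - x))) '' Ioo 0 (1 / 2) = Ioo 0 1 := by
  ext w
  constructor
  · rintro ⟨x, ⟨hx0, hx1⟩, rfl⟩
    have h1 : 0 < x * (1 - x) := by nlinarith
    have h2 : x * (1 - x) < (1 / 2) ^ 2 := by nlinarith [sq_nonneg (1 / 2 - x), sq_pos_of_pos (sub_pos.2 hx1)]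
    refine ⟨by positivity, ?_⟩
    have := (Real.sqrt_lt' (by norm_num : (0 : ℝ) < 1 / 2)).2 h2
    simp only
    linarith
  · rintro ⟨hw0, hw1⟩
    have h1 : 0 < 1 - w ^ 2 := by nlinarith
    have h2 : √(1 - w ^ 2) < 1 := by
      rw [Real.sqrt_lt' one_pos]
      nlinarith
    have h3 : 0 < √(1 - w ^ 2) := Real.sqrt_pos.2 h1
    -- The smaller root of 4x(1 - x) = w².
    refine ⟨(1 - √(1 - w ^ 2)) / 2, ⟨by linarith, by linarith⟩, ?_⟩
    have : (1 - √(1 - w ^ 2)) / 2 * (1 - (1 - √(1 - w ^ 2)) / 2) = (w / 2) ^ 2 := by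
      nlinarith [Real.sq_sqrt h1.le]
    simp only [this]
    rw [Real.sqrt_sq (by linarith)]
    ring

theorem injOn_two_mul_sqrt : InjOn (fun x : ℝ => 2 * √(x * (1 - x))) (Ioo 0 (1 / 2)) := by
  rintro x ⟨hx0, hx1⟩ y ⟨hy0, hy1⟩ h
  have h1 : √(x * (1 - x)) = √(y * (1 - y)) := by simpa using h
  rw [Real.sqrt_inj (by nlinarith) (by nlinarith)] at h1
  have h2 : (x - y) * (1 - x - y) = 0 := by linear_combination h1
  rcases mul_eq_zero.1 h2 with h3 | h3 <;> linarith

theorem hasDerivAt_two_mul_sqrt {x : ℝ} (hx : x ∈ Ioo (0 : ℝ) (1 / 2)) :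
    HasDerivAt (fun x : ℝ => 2 * √(x * (1 - x))) ((1 - 2 * x) / √(x * (1 - x))) x := by
  have h1 : 0 < x * (1 - x) := by nlinarith [hx.1, hx.2]
  have h2 : HasDerivAt (fun x : ℝ => x * (1 - x)) (1 - 2 * x) x := by
    have := (hasDerivAt_id x).mul ((hasDerivAt_id x).const_sub 1)
    convert! this using 1
    simp
    ring
  convert! (h2.sqrt h1.ne').const_mul 2 using 1
  field_simp

/-- The integrand of the Beta function. -/
def betaIntegrand (u v : ℂ) (x : ℝ) : ℂ := (x : ℂ) ^ (u - 1) * (1 - (x : ℂ)) ^ (v - 1)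

/-- Under w = 2√(x(1 - x)) one has √(1 - w²) = 1 - 2x and (1 + √(1 - w²))/w = √((1 - x)/x). The
Jacobian cancels the denominator of the kernel, and its two terms become the Beta integrand at x and
at 1 - x. Writing all powers as exponentials of log x and log(1 - x) reduces this to adding
exponents. -/
theorem halfAngleKernel_comp (a : ℝ) (σ : ℂ) {x : ℝ} (hx : x ∈ Ioo (0 : ℝ) (1 / 2)) :
    |(1 - 2 * x) / √(x * (1 - x))| • (((2 * √(x * (1 - x)) : ℝ) : ℂ) ^ (σ - 1) •
      (halfAngleKernel a (2 * √(x * (1 - x))) : ℂ)) =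
    2 ^ (σ - 1) * (betaIntegrand ((σ - a) / 2) ((σ + a) / 2) x +
      betaIntegrand ((σ - a) / 2) ((σ + a) / 2) (1 - x)) := by
  obtain ⟨hx0, hx1⟩ := hx
  have hy0 : 0 < 1 - x := by linarith
  have hp : 0 < x * (1 - x) := by positivity
  have h2x : 0 < 1 - 2 * x := by linarith
  have hs : √(1 - (2 * √(x * (1 - x))) ^ 2) = 1 - 2 * x := by
    rw [mul_pow, Real.sq_sqrt hp.le, show 1 - 2 ^ 2 * (x * (1 - x)) = (1 - 2 * x) ^ 2 by ring,
      Real.sqrt_sq h2x.le]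
  set X := Real.log x with hX
  set Y := Real.log (1 - x) with hY
  have hxe : x = Real.exp X := (Real.exp_log hx0).symm
  have hye : 1 - x = Real.exp Y := (Real.exp_log hy0).symm
  have hsq : √(x * (1 - x)) = Real.exp ((X + Y) / 2) := by
    rw [hxe, ← hxe, hye, ← hye, Real.sqrt_eq_rpow, Real.rpow_def_of_pos hp,
      Real.log_mul hx0.ne' hy0.ne']
    congr 1
    ring
  have hu : (1 + (1 - 2 * x)) / (2 * √(x * (1 - x))) = Real.exp ((Y - X) / 2) := by
    rw [hsq, show 1 + (1 - 2 * x) = 2 * (1 - x) by ring, hye, mul_div_mul_left _ _ two_ne_zero,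
      ← Real.exp_sub]
    ring_nf
  have hx0' : (x : ℂ) ≠ 0 := by exact_mod_cast hx0.ne'
  have hy0' : (1 - (x : ℂ)) ≠ 0 := by exact_mod_cast hy0.ne'
  have hlogy : Complex.log (1 - (x : ℂ)) = Y := by
    rw [hY, Complex.ofReal_log hy0.le]
    push_cast
    rfl
  have hlogx : Complex.log (x : ℂ) = X := (Complex.ofReal_log hx0.le).symm
  rw [halfAngleKernel, hs, hu, ← Real.exp_mul, ← Real.exp_mul,
    abs_of_pos (div_pos h2x (Real.sqrt_pos.2 hp))]
  have hpow : ((2 * √(x * (1 - x)) : ℝ) : ℂ) ^ (σ - 1) =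
      2 ^ (σ - 1) * Complex.exp (((X : ℂ) + Y) / 2 * (σ - 1)) := by
    rw [Complex.ofReal_mul, Complex.mul_cpow_ofReal_nonneg (by norm_num) (Real.sqrt_nonneg _),
      hsq, Complex.cpow_def_of_ne_zero (x := ((Real.exp ((X + Y) / 2) : ℝ) : ℂ))
      (by exact_mod_cast (Real.exp_pos _).ne'), ← Complex.ofReal_log (Real.exp_pos _).le,
      Real.log_exp]
    push_cast
    rfl
  rw [hpow, betaIntegrand, betaIntegrand]
  rw [show (((1 - x : ℝ)) : ℂ) = 1 - (x : ℂ) by push_cast; rfl, sub_sub_cancel]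
  simp only [Complex.cpow_def_of_ne_zero hx0', Complex.cpow_def_of_ne_zero hy0', hlogx, hlogy]
  rw [hsq, Complex.real_smul, smul_eq_mul]
  push_cast
  have h2x' : (1 - 2 * (x : ℂ)) ≠ 0 := by exact_mod_cast h2x.ne'
  have hE := Complex.exp_ne_zero (((X : ℂ) + Y) / 2)
  rw [show ∀ b E A B C : ℂ, b / E * (A * B * (C / b)) = b / b * (A * (B * C / E)) by
    intros; ring, div_self h2x', one_mul, mul_add, add_div]
  congr 1
  simp only [← Complex.exp_add, ← Complex.exp_sub]
  congr 1 <;> congr 1 <;> ring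

/-- The two terms on (0, 1/2) unfold to a single Beta integral over (0, 1). The hypotheses on σ say
that both Beta parameters have positive real part. -/
theorem integrable_halfAngleKernel_and_integral {a : ℝ} {σ : ℂ} (h1 : a < σ.re) (h2 : -a < σ.re) :
    IntegrableOn (fun w : ℝ => (w : ℂ) ^ (σ - 1) • (halfAngleKernel a w : ℂ)) (Ioo 0 1) ∧
    ∫ w in Ioo (0 : ℝ) 1, (w : ℂ) ^ (σ - 1) • (halfAngleKernel a w : ℂ) =
      2 ^ (σ - 1) * Complex.betaIntegral ((σ - a) / 2) ((σ + a) / 2) := by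
  have hp : 0 < ((σ - a) / 2).re := by
    rw [show (2 : ℂ) = ((2 : ℝ) : ℂ) by norm_num, Complex.div_ofReal_re]
    simp
    linarith
  have hq : 0 < ((σ + a) / 2).re := by
    rw [show (2 : ℂ) = ((2 : ℝ) : ℂ) by norm_num, Complex.div_ofReal_re]
    simp
    linarith
  set β := betaIntegrand ((σ - a) / 2) ((σ + a) / 2) with hβ
  have hI : IntervalIntegrable β volume 0 1 := Complex.betaIntegral_convergent hp hq
  have hI1 : IntervalIntegrable β volume 0 (1 / 2) :=
    hI.mono_set (by rw [uIcc_of_le, uIcc_of_le] <;> [exact Icc_subset_Icc le_rfl (by norm_num); norm_num; norm_num])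
  have hI2 : IntervalIntegrable β volume (1 / 2) 1 :=
    hI.mono_set (by rw [uIcc_of_le, uIcc_of_le] <;> [exact Icc_subset_Icc (by norm_num) le_rfl; norm_num; norm_num])
  have hI3 : IntervalIntegrable (fun x => β (1 - x)) volume 0 (1 / 2) := by
    have := (hI2.comp_sub_left 1).symm
    norm_num at this
    simpa using this
  have hder : ∀ x ∈ Ioo (0 : ℝ) (1 / 2), HasDerivWithinAt (fun x : ℝ => 2 * √(x * (1 - x)))
      ((1 - 2 * x) / √(x * (1 - x))) (Ioo 0 (1 / 2)) x :=
    fun x hx => (hasDerivAt_two_mul_sqrt hx).hasDerivWithinAt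
  rw [← image_two_mul_sqrt,
    integrableOn_image_iff_integrableOn_abs_deriv_smul measurableSet_Ioo hder injOn_two_mul_sqrt,
    integral_image_eq_integral_abs_deriv_smul measurableSet_Ioo hder injOn_two_mul_sqrt]
  constructor
  · refine IntegrableOn.congr_fun ?_ (fun x hx => (halfAngleKernel_comp a σ hx).symm)
      measurableSet_Ioo
    have := (hI1.add hI3).const_mul (2 ^ (σ - 1))
    rw [intervalIntegrable_iff_integrableOn_Ioo_of_le (by norm_num)] at this
    exact this
  · rw [setIntegral_congr_fun measurableSet_Ioo (fun x hx => halfAngleKernel_comp a σ hx),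
      integral_const_mul, ← integral_Ioc_eq_integral_Ioo,
      ← intervalIntegral.integral_of_le (by norm_num)]
    congr 1
    change ∫ x in (0 : ℝ)..(1 / 2), (β x + β (1 - x)) = ∫ x in (0 : ℝ)..1, β x
    rw [intervalIntegral.integral_add hI1 hI3, intervalIntegral.integral_comp_sub_left β 1,
      ← intervalIntegral.integral_add_adjacent_intervals hI1 hI2]
    norm_num

/-- `halfAngleKernel a`, rescaled from `(0, 1)` to `(0, √(27 / 4))` and extended by zero. -/
def scaledKernel (a : ℝ) : ℝ → ℂ :=
  fun x => (Ioo (0 : ℝ) 1).indicator (fun w => (halfAngleKernel a w : ℂ)) (2 / (3 * √3) * x)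

theorem mellin_scaledKernel {a : ℝ} {σ : ℂ} (h1 : a < σ.re) (h2 : -a < σ.re) :
    MellinConvergent (scaledKernel a) σ ∧ mellin (scaledKernel a) σ =
      (3 : ℂ) ^ (3 * σ / 2) / 2 *
        (Complex.Gamma ((σ - a) / 2) * Complex.Gamma ((σ + a) / 2) / Complex.Gamma σ) := by
  obtain ⟨hI, hv⟩ := integrable_halfAngleKernel_and_integral h1 h2
  have hκ : (0 : ℝ) < 2 / (3 * √3) := by positivity
  have hσ : 0 < σ.re := by linarith
  set f : ℝ → ℂ := (Ioo (0 : ℝ) 1).indicator (fun w => (halfAngleKernel a w : ℂ)) with hf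
  have hfun : (fun t : ℝ => (t : ℂ) ^ (σ - 1) • f t) =
      (Ioo (0 : ℝ) 1).indicator (fun t : ℝ => (t : ℂ) ^ (σ - 1) • (halfAngleKernel a t : ℂ)) := by
    ext t
    simp only [hf, indicator]
    split_ifs <;> simp
  have hsub : Ioo (0 : ℝ) 1 ∩ Ioi 0 = Ioo 0 1 := inter_eq_left.2 fun x hx => hx.1
  have hconv : MellinConvergent f σ := by
    rw [MellinConvergent, hfun, IntegrableOn, integrable_indicator_iff measurableSet_Ioo,
      IntegrableOn, Measure.restrict_restrict measurableSet_Ioo, hsub]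
    exact hI
  refine ⟨(MellinConvergent.comp_mul_left hκ).2 hconv, ?_⟩
  have hm : mellin f σ = 2 ^ (σ - 1) * Complex.betaIntegral ((σ - a) / 2) ((σ + a) / 2) := by
    rw [mellin, hfun, integral_indicator measurableSet_Ioo,
      Measure.restrict_restrict measurableSet_Ioo, hsub, hv]
  have hp : 0 < ((σ - a) / 2).re := by
    rw [show (2 : ℂ) = ((2 : ℝ) : ℂ) by norm_num, Complex.div_ofReal_re]
    simp
    linarith
  have hq : 0 < ((σ + a) / 2).re := by
    rw [show (2 : ℂ) = ((2 : ℝ) : ℂ) by norm_num, Complex.div_ofReal_re]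
    simp
    linarith
  have hB := Complex.Gamma_mul_Gamma_eq_betaIntegral hp hq
  rw [show (σ - a) / 2 + (σ + a) / 2 = σ by ring] at hB
  have hΓ := Complex.Gamma_ne_zero_of_re_pos hσ
  change mellin (fun x => f (2 / (3 * √3) * x)) σ = _
  rw [mellin_comp_mul_left _ _ hκ, hm, hB, mul_div_cancel_left₀ _ hΓ, smul_eq_mul, ← mul_assoc]
  congr 1
  -- The dilation contributes (2/(3√3)) to the power -σ, whose power of 2 cancels 2^σ and leaves
  -- 3^(3σ/2).
  have hlog : Real.log (2 / (3 * √3)) = Real.log 2 - 3 / 2 * Real.log 3 := by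
    rw [Real.log_div (by norm_num) (by positivity), Real.log_mul (by norm_num) (by positivity),
      Real.log_sqrt (by norm_num)]
    ring
  have hl2 : Complex.log 2 = (Real.log 2 : ℝ) := by
    rw [Complex.ofReal_log (by norm_num), Complex.ofReal_ofNat]
  have hl3 : Complex.log 3 = (Real.log 3 : ℝ) := by
    rw [Complex.ofReal_log (by norm_num), Complex.ofReal_ofNat]
  rw [Complex.cpow_sub _ _ two_ne_zero, Complex.cpow_one, ← mul_div_assoc]
  congr 1
  rw [Complex.cpow_def_of_ne_zero (by exact_mod_cast hκ.ne'), ← Complex.ofReal_log hκ.le,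
    Complex.cpow_def_of_ne_zero two_ne_zero, Complex.cpow_def_of_ne_zero three_ne_zero,
    hl2, hl3, hlog, ← Complex.exp_add]
  congr 1
  push_cast
  ring

end

/-! ### From the Mellin transform to density and moments -/

theorem Gamma_add_one_eq_prod (a : ℝ) (n : ℕ) (h : 0 < a - n + 1) :
    Real.Gamma (a + 1) = (∏ i ∈ Finset.range n, (a - (i : ℝ))) * Real.Gamma (a - n + 1) := by
  induction n with
  | zero => simp
  | succ n ih =>
    push_cast at h ⊢
    rw [ih (by linarith), Finset.prod_range_succ, mul_assoc,
      show a - (n + 1) + 1 = a - n by ring, Real.Gamma_add_one (by linarith)]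

/-- At σ = n + 1 the Mellin kernel x^(σ - 1) is xⁿ, so these values of ψ are the moments of the
density. -/
theorem psiFun_natCast_add_one {p r : ℝ} (hp : 1 < p) (hr : -1 < r) (n : ℕ) :
    psiFun p r ((n : ℂ) + 1) = (realBinom (n * p + r) n : ℝ) := by
  have h0 : 0 < (n : ℝ) * p + r - n + 1 := by
    have : 0 ≤ (n : ℝ) * (p - 1) := mul_nonneg n.cast_nonneg (by linarith)
    linarith
  have hG := Gamma_add_one_eq_prod (n * p + r) n h0
  have hne := (Real.Gamma_pos_of_pos h0).ne'
  have hfac : (n.factorial : ℝ) ≠ 0 := by positivity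
  rw [psiFun, Complex.Gamma_nat_eq_factorial, realBinom_eq,
    show ((n : ℂ) + 1 - 1) * (p : ℂ) + r + 1 = ((n * p + r + 1 : ℝ) : ℂ) by push_cast; ring,
    show ((n : ℂ) + 1 - 1) * ((p : ℂ) - 1) + r + 1 = ((n * p + r - n + 1 : ℝ) : ℂ) by
      push_cast; ring,
    Complex.Gamma_ofReal, Complex.Gamma_ofReal, hG, ← Complex.ofReal_natCast, ← Complex.ofReal_mul,
    ← Complex.ofReal_div]
  congr 1
  field_simp

/-- `V`, supported on `(0, c)`, is a function with Mellin transform `psiFun p r`. -/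
structure IsPsiDensity (p r c : ℝ) (V : ℝ → ℝ) : Prop where
  nonneg : ∀ x ∈ Ioo 0 c, 0 ≤ V x
  differentiableAt : ∀ x ∈ Ioo 0 c, DifferentiableAt ℝ V x
  convergent : ∀ σ : ℂ, 1 - (1 + r) / p < σ.re →
    MellinConvergent ((Ioo 0 c).indicator fun x => (V x : ℂ)) σ
  mellin_eq : ∀ σ : ℂ, 1 - (1 + r) / p < σ.re →
    mellin ((Ioo 0 c).indicator fun x => (V x : ℂ)) σ = psiFun p r σ

namespace IsPsiDensity

variable {p r c : ℝ} {V : ℝ → ℝ}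

/-- Inversion holds separately on every admissible line with the same limit, so independence of d
needs no contour shift. -/
theorem tendsto (h : IsPsiDensity p r c V) {d : ℝ} (hd : 1 - (1 + r) / p < d) {x : ℝ}
    (hx : x ∈ Ioo 0 c) :
    Tendsto (fun T : ℝ => mellinInvTrunc (psiFun p r) d x T) atTop (𝓝 (V x : ℂ)) := by
  have hev : (Ioo 0 c).indicator (fun x => (V x : ℂ)) =ᶠ[𝓝 x] fun x => (V x : ℂ) := by
    filter_upwards [isOpen_Ioo.mem_nhds hx] with u hu using indicator_of_mem hu _
  have hdiff : DifferentiableAt ℝ ((Ioo 0 c).indicator fun x => (V x : ℂ)) x :=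
    ((Complex.ofRealCLM.differentiableAt).comp x (h.differentiableAt x hx)).congr_of_eventuallyEq hev
  have := tendsto_mellinInvTrunc hx.1 (h.convergent d (by simpa using hd)) hdiff
    (φ := psiFun p r) (fun t => (h.mellin_eq _ (by simpa using hd)).symm)
  rwa [indicator_of_mem hx] at this

theorem binomialDensity_eq (h : IsPsiDensity p r c V) {x : ℝ} (hx : x ∈ Ioo 0 c) :
    binomialDensity p r x = V x := by
  rw [binomialDensity, (h.tendsto (by linarith) hx).limUnder_eq, Complex.ofReal_re]

theorem mellin_integrand (V : ℝ → ℝ) (n : ℕ) :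
    (fun t : ℝ => (t : ℂ) ^ ((n : ℂ) + 1 - 1) • (Ioo 0 c).indicator (fun x => (V x : ℂ)) t) =
      (Ioo 0 c).indicator fun t => ((t ^ n * V t : ℝ) : ℂ) := by
  ext t
  simp only [indicator, add_sub_cancel_right, Complex.cpow_natCast]
  split_ifs <;> simp

theorem integrableOn_pow_mul (h : IsPsiDensity p r c V) (hp : 1 < p) (hr : -1 < r) (n : ℕ) :
    IntegrableOn (fun x => x ^ n * V x) (Ioo 0 c) := by
  have hd : 1 - (1 + r) / p < ((n : ℂ) + 1).re := by
    have : 0 < (1 + r) / p := div_pos (by linarith) (by linarith)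
    have := n.cast_nonneg (α := ℝ)
    simp
    linarith
  have := h.convergent _ hd
  rw [MellinConvergent, mellin_integrand, IntegrableOn, integrable_indicator_iff measurableSet_Ioo,
    IntegrableOn, Measure.restrict_restrict measurableSet_Ioo,
    inter_eq_left.2 fun x hx => hx.1] at this
  simpa only [IntegrableOn, RCLike.re_to_complex, Complex.ofReal_re] using this.re

theorem integral_pow_mul (h : IsPsiDensity p r c V) (hp : 1 < p) (hr : -1 < r) (n : ℕ) :
    ∫ x in Ioo 0 c, x ^ n * V x = realBinom (n * p + r) n := by
  have hd : 1 - (1 + r) / p < ((n : ℂ) + 1).re := by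
    have : 0 < (1 + r) / p := div_pos (by linarith) (by linarith)
    have := n.cast_nonneg (α := ℝ)
    simp
    linarith
  have := h.mellin_eq _ hd
  rw [mellin, mellin_integrand, integral_indicator measurableSet_Ioo,
    Measure.restrict_restrict measurableSet_Ioo, inter_eq_left.2 fun x hx => hx.1,
    integral_complex_ofReal, psiFun_natCast_add_one hp hr] at this
  exact_mod_cast this

theorem binomialDensity_nonneg (h : IsPsiDensity p r c V) {x : ℝ} (hx : x ∈ Ioo 0 c) :
    0 ≤ binomialDensity p r x :=
  h.binomialDensity_eq hx ▸ h.nonneg x hx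

theorem integrableOn_pow_mul_binomialDensity (h : IsPsiDensity p r c V) (hp : 1 < p) (hr : -1 < r)
    (n : ℕ) : IntegrableOn (fun x => x ^ n * binomialDensity p r x) (Ioo 0 c) :=
  (h.integrableOn_pow_mul hp hr n).congr_fun
    (fun x hx => by simp only [h.binomialDensity_eq hx]) measurableSet_Ioo

theorem integral_pow_mul_binomialDensity (h : IsPsiDensity p r c V) (hp : 1 < p) (hr : -1 < r)
    (n : ℕ) : ∫ x in Ioo 0 c, x ^ n * binomialDensity p r x = realBinom (n * p + r) n := by
  rw [← h.integral_pow_mul hp hr n]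
  exact setIntegral_congr_fun measurableSet_Ioo fun x hx => by simp only [h.binomialDensity_eq hx]

theorem hasMomentSequence_iff (h : IsPsiDensity p r c V) (hp : 1 < p) (hr : -1 < r)
    (ν : Measure ℝ) :
    HasMomentSequence ν (fun n : ℕ => realBinom ((n : ℝ) * p + r) n) ↔
      ν = densityMeasure (binomialDensity p r) c :=
  hasMomentSequence_iff_eq_densityMeasure (fun _ hx => h.binomialDensity_nonneg hx)
    (h.integrableOn_pow_mul_binomialDensity hp hr) (h.integral_pow_mul_binomialDensity hp hr)
    (by simp [realBinom_eq]) ν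

end IsPsiDensity

/-! ### The three densities for p = 3/2 -/

theorem sqrt_27_div_4 : √(27 / 4) = 3 * √3 / 2 := by
  rw [Real.sqrt_eq_iff_mul_self_eq_of_pos (by positivity)]
  have := Real.mul_self_sqrt (show (0 : ℝ) ≤ 3 by norm_num)
  nlinarith

theorem scale_mem_Ioo_iff {x : ℝ} :
    2 / (3 * √3) * x ∈ Ioo (0 : ℝ) 1 ↔ x ∈ Ioo (0 : ℝ) (√(27 / 4)) := by
  have h3 : 0 < √3 := by positivity
  rw [sqrt_27_div_4]
  simp only [mem_Ioo]
  rw [div_mul_eq_mul_div, div_lt_one (by positivity : 0 < 3 * √3), lt_div_iff₀ (zero_lt_two' ℝ)]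
  constructor
  · rintro ⟨h1, h2⟩
    refine ⟨?_, by linarith⟩
    by_contra hx
    exact absurd h1 (not_lt.2 (div_nonpos_of_nonpos_of_nonneg (by linarith) (by positivity)))
  · rintro ⟨h1, h2⟩
    exact ⟨by positivity, by linarith⟩

theorem scaledKernel_eq_indicator (a : ℝ) :
    scaledKernel a = (Ioo (0 : ℝ) (√(27 / 4))).indicator
      fun x => (halfAngleKernel a (2 / (3 * √3) * x) : ℂ) := by
  ext x
  simp only [scaledKernel, indicator, scale_mem_Ioo_iff]

theorem indicator_const_mul_eq (K a : ℝ) :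
    ((Ioo (0 : ℝ) (√(27 / 4))).indicator
      fun x => ((K * halfAngleKernel a (2 / (3 * √3) * x) : ℝ) : ℂ)) =
      fun x => (K : ℂ) • scaledKernel a x := by
  ext x
  rw [scaledKernel_eq_indicator]
  simp only [indicator]
  split_ifs <;> simp

theorem scaledKernel_nonneg_differentiableAt (K a : ℝ) (hK : 0 ≤ K) :
    (∀ x ∈ Ioo (0 : ℝ) (√(27 / 4)), 0 ≤ K * halfAngleKernel a (2 / (3 * √3) * x)) ∧
    ∀ x ∈ Ioo (0 : ℝ) (√(27 / 4)),
      DifferentiableAt ℝ (fun x => K * halfAngleKernel a (2 / (3 * √3) * x)) x := by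
  refine ⟨fun x hx => mul_nonneg hK (halfAngleKernel_nonneg a (scale_mem_Ioo_iff.2 hx).1),
    fun x hx => DifferentiableAt.const_mul ?_ K⟩
  exact DifferentiableAt.comp (g := halfAngleKernel a) x
    (differentiableAt_halfAngleKernel a (scale_mem_Ioo_iff.2 hx)) (by fun_prop)

theorem sqrt_three_eq_cpow : ((√3 : ℝ) : ℂ) = (3 : ℂ) ^ (1 / 2 : ℂ) := by
  rw [Real.sqrt_eq_rpow, Complex.ofReal_cpow (by norm_num)]
  norm_num

theorem one_third_cpow (s : ℂ) : (1 / 3 : ℂ) ^ s = (3 : ℂ) ^ (-s) := by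
  rw [one_div, Complex.cpow_neg, Complex.inv_cpow]
  rw [← Complex.ofReal_ofNat, Complex.arg_ofReal_of_nonneg (by norm_num)]
  exact Real.pi_pos.ne

/-- With w = (σ - 1/3)/2 the denominator factor is Γ(w + 2/3), so triplication leaves Γ(w)Γ(w +
1/3), the Beta numerator for a = 1/3. -/
theorem isPsiDensity_zero :
    IsPsiDensity (3 / 2) 0 (√(27 / 4))
      (fun x => 1 / (3 * Real.pi) * halfAngleKernel (1 / 3) (2 / (3 * √3) * x)) := by
  have hπ : (Real.pi : ℂ) ≠ 0 := by exact_mod_cast Real.pi_ne_zero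
  obtain ⟨h1, h2⟩ := scaledKernel_nonneg_differentiableAt (1 / (3 * Real.pi)) (1 / 3) (by positivity)
  refine ⟨h1, h2, fun σ hσ => ?_, fun σ hσ => ?_⟩ <;> norm_num at hσ
  · rw [indicator_const_mul_eq]
    exact (mellin_scaledKernel (by linarith) (by linarith)).1.const_smul _
  · rw [indicator_const_mul_eq, mellin_const_smul,
      (mellin_scaledKernel (a := 1 / 3) (by linarith) (by linarith)).2, psiFun]
    have hw : 0 < ((σ - 1 / 3) / 2).re := by
      rw [show (2 : ℂ) = ((2 : ℝ) : ℂ) by norm_num, Complex.div_ofReal_re]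
      norm_num
      linarith
    have htri := Gamma_triplication hw
    have hΓ : Complex.Gamma ((σ - 1 / 3) / 2 + 2 / 3) ≠ 0 :=
      Complex.Gamma_ne_zero_of_re_pos (by simp only [Complex.add_re]; norm_num at hw ⊢; linarith)
    have hΓσ : Complex.Gamma σ ≠ 0 := Complex.Gamma_ne_zero_of_re_pos (by linarith)
    push_cast
    rw [show (σ + 1 / 3) / 2 = (σ - 1 / 3) / 2 + 1 / 3 by ring,
      show (σ - 1) * (3 / 2) + 0 + 1 = 3 * ((σ - 1 / 3) / 2) by ring,
      show (σ - 1) * (3 / 2 - 1) + 0 + 1 = (σ - 1 / 3) / 2 + 2 / 3 by ring, smul_eq_mul]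
    -- The exponents of 3 differ by 1/2; together with 2π√3 from triplication and the 1/2 of the
    -- kernel this gives 3π, which the constant in front of the kernel normalizes.
    have h3 : (3 : ℂ) ^ (3 * σ / 2) * (1 / 3 : ℂ) ^ (3 * ((σ - 1 / 3) / 2)) = ((√3 : ℝ) : ℂ) := by
      rw [one_third_cpow, ← Complex.cpow_add _ _ three_ne_zero, sqrt_three_eq_cpow]
      ring_nf
    have hs3 : ((√3 : ℝ) : ℂ) * ((√3 : ℝ) : ℂ) = 3 := by
      rw [← Complex.ofReal_mul, Real.mul_self_sqrt (by norm_num)]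
      norm_num
    push_cast at htri
    generalize (3 : ℂ) ^ (3 * σ / 2) = t, (1 / 3 : ℂ) ^ (3 * ((σ - 1 / 3) / 2)) = t' at h3 htri ⊢
    generalize (σ - 1 / 3) / 2 = w at hΓ htri ⊢
    generalize Complex.Gamma w = G₀, Complex.Gamma (w + 1 / 3) = G₁,
      Complex.Gamma (w + 2 / 3) = G₂, Complex.Gamma (3 * w) = G at hΓ htri ⊢
    field_simp
    linear_combination t * htri + G * 2 * Real.pi * √3 * h3 + G * 2 * Real.pi * hs3

/-- With w = (σ - 2/3)/2 it is now Γ(w + 1/3) that cancels, leaving the Beta numerator for a = 2/3.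
-/
theorem isPsiDensity_neg_half :
    IsPsiDensity (3 / 2) (-(1 / 2)) (√(27 / 4))
      (fun x => 1 / (3 * √3 * Real.pi) * halfAngleKernel (2 / 3) (2 / (3 * √3) * x)) := by
  have hπ : (Real.pi : ℂ) ≠ 0 := by exact_mod_cast Real.pi_ne_zero
  obtain ⟨h1, h2⟩ :=
    scaledKernel_nonneg_differentiableAt (1 / (3 * √3 * Real.pi)) (2 / 3) (by positivity)
  refine ⟨h1, h2, fun σ hσ => ?_, fun σ hσ => ?_⟩ <;> norm_num at hσ
  · rw [indicator_const_mul_eq]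
    exact (mellin_scaledKernel (by linarith) (by linarith)).1.const_smul _
  · rw [indicator_const_mul_eq, mellin_const_smul,
      (mellin_scaledKernel (a := 2 / 3) (by linarith) (by linarith)).2, psiFun]
    have hw : 0 < ((σ - 2 / 3) / 2).re := by
      rw [show (2 : ℂ) = ((2 : ℝ) : ℂ) by norm_num, Complex.div_ofReal_re]
      norm_num
      linarith
    have htri := Gamma_triplication hw
    have hΓ : Complex.Gamma ((σ - 2 / 3) / 2 + 1 / 3) ≠ 0 :=
      Complex.Gamma_ne_zero_of_re_pos (by simp only [Complex.add_re]; norm_num at hw ⊢; linarith)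
    have hΓσ : Complex.Gamma σ ≠ 0 := Complex.Gamma_ne_zero_of_re_pos (by linarith)
    push_cast
    rw [show (σ + 2 / 3) / 2 = (σ - 2 / 3) / 2 + 2 / 3 by ring,
      show (σ - 1) * (3 / 2) + -(1 / 2) + 1 = 3 * ((σ - 2 / 3) / 2) by ring,
      show (σ - 1) * (3 / 2 - 1) + -(1 / 2) + 1 = (σ - 2 / 3) / 2 + 1 / 3 by ring, smul_eq_mul]
    have h3 : (3 : ℂ) ^ (3 * σ / 2) * (1 / 3 : ℂ) ^ (3 * ((σ - 2 / 3) / 2)) = 3 := by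
      rw [one_third_cpow, ← Complex.cpow_add _ _ three_ne_zero]
      ring_nf
      simp
    have hs3 : ((√3 : ℝ) : ℂ) ≠ 0 := by
      exact_mod_cast (by positivity : √3 ≠ 0)
    push_cast at htri
    generalize (3 : ℂ) ^ (3 * σ / 2) = t, (1 / 3 : ℂ) ^ (3 * ((σ - 2 / 3) / 2)) = t' at h3 htri ⊢
    generalize (σ - 2 / 3) / 2 = w at hΓ htri ⊢
    generalize Complex.Gamma w = G₀, Complex.Gamma (w + 1 / 3) = G₁,
      Complex.Gamma (w + 2 / 3) = G₂, Complex.Gamma (3 * w) = G at hΓ htri ⊢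
    field_simp
    linear_combination t * htri + G * 2 * Real.pi * √3 * h3

/-- The functional equation gives Γ(σ + 1) = σΓ(σ) and Γ(3σ/2 + 1) = (3σ/2)Γ(3σ/2), while the third
Gamma factor is unchanged. On the density side the shift is multiplication by x. -/
theorem psiFun_half (σ : ℂ) (hσ : 0 < σ.re) :
    psiFun (3 / 2) (1 / 2) σ = 2 / 3 * psiFun (3 / 2) 0 (σ + 1) := by
  have hσ0 : σ ≠ 0 := fun h => by simp [h] at hσ
  rw [psiFun, psiFun]
  push_cast
  rw [Complex.Gamma_add_one σ hσ0,
    show (σ - 1) * (3 / 2) + 1 / 2 + 1 = 3 / 2 * σ + 0 by ring,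
    show (σ + 1 - 1) * (3 / 2) + 0 + 1 = 3 / 2 * σ + 1 by ring,
    show (σ - 1) * (3 / 2 - 1) + 1 / 2 + 1 = σ / 2 + 1 by ring,
    show (σ + 1 - 1) * (3 / 2 - 1) + 0 + 1 = σ / 2 + 1 by ring, add_zero,
    Complex.Gamma_add_one (3 / 2 * σ) (by simpa using hσ0)]
  field_simp

theorem isPsiDensity_half :
    IsPsiDensity (3 / 2) (1 / 2) (√(27 / 4))
      (fun x => 2 / 3 * x * (1 / (3 * Real.pi) * halfAngleKernel (1 / 3) (2 / (3 * √3) * x))) := by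
  have h := isPsiDensity_zero
  set V : ℝ → ℝ := fun x => 1 / (3 * Real.pi) * halfAngleKernel (1 / 3) (2 / (3 * √3) * x)
  have hfun : ((Ioo (0 : ℝ) (√(27 / 4))).indicator fun x => ((2 / 3 * x * V x : ℝ) : ℂ)) =
      fun x : ℝ => (2 / 3 : ℂ) • ((x : ℂ) ^ (1 : ℂ) •
        (Ioo (0 : ℝ) (√(27 / 4))).indicator (fun x => (V x : ℂ)) x) := by
    ext x
    simp only [indicator, Complex.cpow_one]
    split_ifs
    · simp [mul_assoc]
    · simp
  refine ⟨fun x hx => mul_nonneg (mul_nonneg (by norm_num) hx.1.le) (h.nonneg x hx), fun x hx => ?_,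
    fun σ hσ => ?_, fun σ hσ => ?_⟩
  · exact DifferentiableAt.mul (by fun_prop) (h.differentiableAt x hx)
  · norm_num at hσ
    rw [hfun]
    refine MellinConvergent.const_smul (MellinConvergent.cpow_smul.2 (h.convergent _ ?_)) _
    norm_num
    linarith
  · norm_num at hσ
    rw [hfun, mellin_const_smul, mellin_cpow_smul, h.mellin_eq _ (by norm_num; linarith),
      psiFun_half σ hσ, smul_eq_mul]

/-! ### Dilation and squaring -/

/-- Moments of a dilated density. -/
theorem moments_dilate {g : ℝ → ℝ} {c b : ℝ} (hb : 0 < b) (n : ℕ)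
    (hg : IntegrableOn (fun x => x ^ n * g x) (Ioo 0 c)) :
    IntegrableOn (fun x => x ^ n * (g (x / b) / b)) (Ioo 0 (b * c)) ∧
    ∫ x in Ioo 0 (b * c), x ^ n * (g (x / b) / b) =
      b ^ n * ∫ x in Ioo 0 c, x ^ n * g x := by
  have himg : (fun y => b * y) '' Ioo 0 c = Ioo 0 (b * c) := by
    rw [image_mul_left_Ioo hb, mul_zero]
  have hd : ∀ y ∈ Ioo 0 c, HasDerivWithinAt (fun y => b * y) b (Ioo 0 c) y := fun y _ => by
    simpa using ((hasDerivAt_id y).const_mul b).hasDerivWithinAt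
  have hinj : InjOn (fun y => b * y) (Ioo 0 c) := fun x _ y _ h => mul_left_cancel₀ hb.ne' h
  have hfun : (fun y => |b| • ((b * y) ^ n * (g (b * y / b) / b))) =
      fun y => b ^ n * (y ^ n * g y) := by
    ext y
    rw [abs_of_pos hb, mul_div_cancel_left₀ _ hb.ne', smul_eq_mul, mul_pow]
    field_simp
  rw [← himg, integrableOn_image_iff_integrableOn_abs_deriv_smul measurableSet_Ioo hd hinj,
    integral_image_eq_integral_abs_deriv_smul measurableSet_Ioo hd hinj, hfun, integral_const_mul]
  exact ⟨hg.const_mul _, rfl⟩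

/-- Moments of the image of a density under squaring. -/
theorem moments_sq {g : ℝ → ℝ} {c : ℝ} (hc : 0 ≤ c) (n : ℕ)
    (hg : IntegrableOn (fun x => x ^ (2 * n) * g x) (Ioo 0 c)) :
    IntegrableOn (fun x => x ^ n * (g (√x) / (2 * √x))) (Ioo 0 (c ^ 2)) ∧
    ∫ x in Ioo 0 (c ^ 2), x ^ n * (g (√x) / (2 * √x)) =
      ∫ x in Ioo 0 c, x ^ (2 * n) * g x := by
  have himg : (fun y : ℝ => y ^ 2) '' Ioo 0 c = Ioo 0 (c ^ 2) := by
    ext x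
    constructor
    · rintro ⟨y, hy, rfl⟩
      exact ⟨by have := hy.1; positivity, pow_lt_pow_left₀ hy.2 hy.1.le two_ne_zero⟩
    · rintro ⟨h1, h2⟩
      exact ⟨√x, ⟨Real.sqrt_pos.2 h1, (Real.sqrt_lt_sqrt h1.le h2).trans_eq (Real.sqrt_sq hc)⟩,
        Real.sq_sqrt h1.le⟩
  have hd : ∀ y ∈ Ioo 0 c, HasDerivWithinAt (fun y : ℝ => y ^ 2) (2 * y) (Ioo 0 c) y :=
    fun y _ => by simpa using (hasDerivAt_pow 2 y).hasDerivWithinAt (s := Ioo 0 c)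
  have hinj : InjOn (fun y : ℝ => y ^ 2) (Ioo 0 c) := fun x hx y hy h =>
    (pow_left_inj₀ hx.1.le hy.1.le two_ne_zero).1 h
  have hfun : EqOn (fun y => y ^ (2 * n) * g y)
      (fun y => |2 * y| • ((y ^ 2) ^ n * (g (√(y ^ 2)) / (2 * √(y ^ 2))))) (Ioo 0 c) := by
    intro y hy
    have hy0 := hy.1
    simp only
    rw [abs_of_pos (by positivity), Real.sqrt_sq hy0.le, smul_eq_mul, pow_mul]
    field_simp
  rw [← himg, integrableOn_image_iff_integrableOn_abs_deriv_smul measurableSet_Ioo hd hinj,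
    integral_image_eq_integral_abs_deriv_smul measurableSet_Ioo hd hinj,
    setIntegral_congr_fun measurableSet_Ioo hfun]
  exact ⟨hg.congr_fun hfun measurableSet_Ioo, rfl⟩

/-! ### Closed forms of the densities -/

theorem halfAngleKernel_eq (a : ℝ) {w : ℝ} (hw : 0 < w) :
    halfAngleKernel a w = ((1 + √(1 - w ^ 2)) ^ a * w ^ (-a) +
      (1 + √(1 - w ^ 2)) ^ (-a) * w ^ a) / √(1 - w ^ 2) := by
  have h1 : 0 ≤ 1 + √(1 - w ^ 2) := by positivity
  rw [halfAngleKernel, Real.div_rpow h1 hw.le, Real.div_rpow h1 hw.le, Real.rpow_neg hw.le,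
    div_inv_eq_mul, div_eq_mul_inv _ (w ^ a)]

theorem sq_rpow {w : ℝ} (hw : 0 ≤ w) (b : ℝ) : (w ^ 2) ^ b = w ^ (2 * b) := by
  rw [← Real.rpow_natCast, ← Real.rpow_mul hw]
  norm_num

theorem four_mul_sq_div_27 (x : ℝ) : 4 * x ^ 2 / 27 = (2 / (3 * √3) * x) ^ 2 := by
  rw [mul_pow, div_pow, mul_pow, Real.sq_sqrt (by norm_num)]
  ring

theorem binomialDensity_neg_half_eq {x z : ℝ} (hx : x ∈ Ioo (0 : ℝ) (√(27 / 4)))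
    (hz : z = 4 * x ^ 2 / 27) :
    binomialDensity (3 / 2) (-(1 / 2)) x =
      (1 + √(1 - z)) ^ (2 / 3 : ℝ) / (3 * Real.pi * √(3 * (1 - z))) * z ^ (-(1 / 3) : ℝ) +
      (1 + √(1 - z)) ^ (-(2 / 3) : ℝ) / (3 * Real.pi * √(3 * (1 - z))) * z ^ (1 / 3 : ℝ) := by
  have hw := (scale_mem_Ioo_iff.2 hx).1
  rw [isPsiDensity_neg_half.binomialDensity_eq hx, halfAngleKernel_eq _ hw, hz,
    four_mul_sq_div_27, sq_rpow hw.le, sq_rpow hw.le, Real.sqrt_mul (by norm_num),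
    show (2 * -(1 / 3) : ℝ) = -(2 / 3) by norm_num, show (2 * (1 / 3) : ℝ) = 2 / 3 by norm_num]
  generalize 2 / (3 * √3) * x = w
  simp only [div_eq_mul_inv, mul_inv]
  ring

theorem binomialDensity_zero_eq {x z : ℝ} (hx : x ∈ Ioo (0 : ℝ) (√(27 / 4)))
    (hz : z = 4 * x ^ 2 / 27) :
    binomialDensity (3 / 2) 0 x =
      (1 + √(1 - z)) ^ (1 / 3 : ℝ) / (3 * Real.pi * √(1 - z)) * z ^ (-(1 / 6) : ℝ) +
      (1 + √(1 - z)) ^ (-(1 / 3) : ℝ) / (3 * Real.pi * √(1 - z)) * z ^ (1 / 6 : ℝ) := by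
  have hw := (scale_mem_Ioo_iff.2 hx).1
  rw [isPsiDensity_zero.binomialDensity_eq hx, halfAngleKernel_eq _ hw, hz,
    four_mul_sq_div_27, sq_rpow hw.le, sq_rpow hw.le,
    show (2 * -(1 / 6) : ℝ) = -(1 / 3) by norm_num, show (2 * (1 / 6) : ℝ) = 1 / 3 by norm_num]
  generalize 2 / (3 * √3) * x = w
  simp only [div_eq_mul_inv, mul_inv]
  ring

theorem binomialDensity_half_eq {x z : ℝ} (hx : x ∈ Ioo (0 : ℝ) (√(27 / 4)))
    (hz : z = 4 * x ^ 2 / 27) :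
    binomialDensity (3 / 2) (1 / 2) x =
      (1 + √(1 - z)) ^ (1 / 3 : ℝ) / (Real.pi * √(3 * (1 - z))) * z ^ (1 / 3 : ℝ) +
      (1 + √(1 - z)) ^ (-(1 / 3) : ℝ) / (Real.pi * √(3 * (1 - z))) * z ^ (2 / 3 : ℝ) := by
  have hw := (scale_mem_Ioo_iff.2 hx).1
  have h3 : √3 * √3 = 3 := Real.mul_self_sqrt (by norm_num)
  have h30 : √3 ≠ 0 := by positivity
  -- The extra factor x is a multiple of w = √z, so it raises both exponents of z by 1/2.
  have hxw : 2 / 3 * x = √3 * (2 / (3 * √3) * x) := by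
    field_simp
  rw [isPsiDensity_half.binomialDensity_eq hx, hxw, halfAngleKernel_eq _ hw, hz,
    four_mul_sq_div_27]
  set w := 2 / (3 * √3) * x
  rw [sq_rpow hw.le, sq_rpow hw.le, Real.sqrt_mul (by norm_num),
    show (2 * (1 / 3) : ℝ) = 1 + -(1 / 3) by norm_num,
    show (2 * (2 / 3) : ℝ) = 1 + 1 / 3 by norm_num, Real.rpow_add hw, Real.rpow_add hw,
    Real.rpow_one]
  have hinv : √3 / 3 = (√3)⁻¹ := by
    field_simp
    linear_combination h3
  generalize (1 + √(1 - w ^ 2)) ^ (1 / 3 : ℝ) = A, (1 + √(1 - w ^ 2)) ^ (-(1 / 3) : ℝ) = B,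
    w ^ (-(1 / 3) : ℝ) = C, w ^ (1 / 3 : ℝ) = D
  calc _ = √3 / 3 * (w * Real.pi⁻¹ * (A * C + B * D) * (√(1 - w ^ 2))⁻¹) := by ring
    _ = _ := by
      rw [hinv]
      simp only [div_eq_mul_inv, mul_inv]
      ring

theorem dilated_mem_Ioo {x : ℝ} (hx : x ∈ Ioo (0 : ℝ) (6 * √3)) :
    x / 4 ∈ Ioo (0 : ℝ) (√(27 / 4)) := by
  rw [sqrt_27_div_4]
  exact ⟨div_pos hx.1 (by norm_num), by linarith [hx.2]⟩

theorem binomialDensity_neg_half_dilated_eq {x : ℝ} (hx : x ∈ Ioo (0 : ℝ) (6 * √3)) :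
    binomialDensity (3 / 2) (-(1 / 2)) (x / 4) / 4 =
      (x ^ (4 / 3 : ℝ) +
          9 * (2 : ℝ) ^ (4 / 3 : ℝ) * (1 + √(1 - x ^ 2 / 108)) ^ (4 / 3 : ℝ)) /
        ((2 : ℝ) ^ (8 / 3 : ℝ) * (3 : ℝ) ^ (5 / 2 : ℝ) * Real.pi * x ^ (2 / 3 : ℝ) *
          √(1 - x ^ 2 / 108) * (1 + √(1 - x ^ 2 / 108)) ^ (2 / 3 : ℝ)) := by
  have hx' := dilated_mem_Ioo hx
  have hx0 := hx.1
  have hw := scale_mem_Ioo_iff.2 hx'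
  have hwx : (2 / (3 * √3) * (x / 4)) ^ 2 = x ^ 2 / 108 := by
    rw [← four_mul_sq_div_27]
    ring
  rw [isPsiDensity_neg_half.binomialDensity_eq hx', halfAngleKernel_eq _ hw.1, hwx]
  have hs : 0 < √(1 - x ^ 2 / 108) := by
    rw [← hwx]
    exact Real.sqrt_pos.2 (by nlinarith [hw.1, hw.2])
  have h30 : 0 < √3 := by positivity
  set s := √(1 - x ^ 2 / 108)
  have hw23 : (2 / (3 * √3) * (x / 4)) ^ (2 / 3 : ℝ) = x ^ (2 / 3 : ℝ) / (3 * 2 ^ (2 / 3 : ℝ)) := by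
    have : 2 / (3 * √3) * (x / 4) = x / ((3 : ℝ) ^ (3 / 2 : ℝ) * 2) := by
      rw [show (3 / 2 : ℝ) = 1 + 1 / 2 by norm_num, Real.rpow_add (by norm_num), Real.rpow_one,
        ← Real.sqrt_eq_rpow]
      field_simp
      norm_num
    rw [this, Real.div_rpow hx0.le (by positivity), Real.mul_rpow (by positivity) (by norm_num),
      ← Real.rpow_mul (by norm_num)]
    norm_num
  have h352 : (3 : ℝ) ^ (5 / 2 : ℝ) = 9 * √3 := by
    rw [show (5 / 2 : ℝ) = (2 : ℕ) + 1 / 2 by norm_num, Real.rpow_add (by norm_num),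
      Real.rpow_natCast, ← Real.sqrt_eq_rpow]
    norm_num
  -- The two terms of the kernel contain reciprocal 2/3-powers; over a common denominator these
  -- become squares, the 4/3-powers of the closed form.
  have h43 : ∀ y : ℝ, 0 < y → y ^ (4 / 3 : ℝ) = y ^ (2 / 3 : ℝ) * y ^ (2 / 3 : ℝ) := by
    intro y hy
    rw [← Real.rpow_add hy]
    norm_num
  have h83 : (2 : ℝ) ^ (8 / 3 : ℝ) = 4 * 2 ^ (2 / 3 : ℝ) := by
    rw [show (8 / 3 : ℝ) = (2 : ℕ) + 2 / 3 by norm_num, Real.rpow_add (by norm_num),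
      Real.rpow_natCast]
    norm_num
  rw [Real.rpow_neg hw.1.le, Real.rpow_neg (by positivity), hw23, h352, h83, h43 x hx0,
    h43 2 (by norm_num), h43 (1 + s) (by positivity)]
  have hA : 0 < x ^ (2 / 3 : ℝ) := by positivity
  have hB : (0 : ℝ) < 2 ^ (2 / 3 : ℝ) := by positivity
  have hC : 0 < (1 + s) ^ (2 / 3 : ℝ) := by positivity
  generalize x ^ (2 / 3 : ℝ) = A at hA ⊢
  generalize (2 : ℝ) ^ (2 / 3 : ℝ) = B at hB ⊢
  generalize (1 + s) ^ (2 / 3 : ℝ) = C at hC ⊢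
  have hπ := Real.pi_pos
  field_simp
  ring

/-! ### The integer sequences and their measures -/

theorem Gamma_nat_add_half_mul_factorial (k : ℕ) :
    Real.Gamma (k + 1 / 2) * k.factorial = (2 * k).factorial / 4 ^ k * √Real.pi := by
  have h := Real.Gamma_mul_Gamma_add_half ((k : ℝ) + 1 / 2)
  rw [show (k : ℝ) + 1 / 2 + 1 / 2 = k + 1 by ring, Real.Gamma_nat_eq_factorial,
    show 2 * ((k : ℝ) + 1 / 2) = (2 * k : ℕ) + 1 by push_cast; ring,
    Real.Gamma_nat_eq_factorial, show (1 : ℝ) - ((2 * k : ℕ) + 1) = -(2 * k : ℕ) by ring,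
    Real.rpow_neg (by norm_num), Real.rpow_natCast, pow_mul] at h
  rw [h, show (2 : ℝ) ^ 2 = 4 by norm_num, div_eq_mul_inv]

/-- The falling product is Γ(3n + 1/2)/Γ(n + 1/2). Legendre duplication turns both values into
factorials; √π cancels, and 4³ⁿ/4ⁿ = 16ⁿ absorbs the normalization. -/
theorem realBinom_mul_pow_eq_seqA061162 (n : ℕ) :
    realBinom (3 * (n : ℝ) - 1 / 2) (2 * n) * 16 ^ n = seqA061162 n := by
  have hG := Gamma_add_one_eq_prod (3 * (n : ℝ) - 1 / 2) (2 * n) (by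
    push_cast
    have := n.cast_nonneg (α := ℝ)
    linarith)
  have h3 := Gamma_nat_add_half_mul_factorial (3 * n)
  have h1 := Gamma_nat_add_half_mul_factorial n
  rw [show 2 * (3 * n) = 6 * n by ring] at h3
  rw [show 3 * (n : ℝ) - 1 / 2 + 1 = (3 * n : ℕ) + 1 / 2 by push_cast; ring,
    show 3 * (n : ℝ) - 1 / 2 - (2 * n : ℕ) + 1 = n + 1 / 2 by push_cast; ring] at hG
  rw [hG, show (4 : ℝ) ^ (3 * n) = 16 ^ n * 4 ^ n by
    rw [show 3 * n = 2 * n + n by ring, pow_add, pow_mul]; norm_num] at h3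
  rw [realBinom_eq, seqA061162]
  generalize ∏ i ∈ Finset.range (2 * n), (3 * (n : ℝ) - 1 / 2 - (i : ℝ)) = P at h3 ⊢
  have hπ : √Real.pi ≠ 0 := by have := Real.pi_pos; positivity
  have hf1 : (n.factorial : ℝ) ≠ 0 := by positivity
  have hf2 : ((2 * n).factorial : ℝ) ≠ 0 := by positivity
  have hf3 : ((3 * n).factorial : ℝ) ≠ 0 := by positivity
  have h4 : (4 : ℝ) ^ n ≠ 0 := by positivity
  have h16 : (16 : ℝ) ^ n ≠ 0 := by positivity
  have hΓ : Real.Gamma (n + 1 / 2) = (2 * n).factorial / 4 ^ n * √Real.pi / n.factorial :=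
    eq_div_of_mul_eq hf1 h1
  rw [hΓ] at h3
  generalize (4 : ℝ) ^ n = a at h4 h3
  generalize (16 : ℝ) ^ n = b at h16 h3 ⊢
  field_simp at h3 ⊢
  linear_combination h3

theorem seqA091527_two_mul (n : ℕ) : seqA091527 (2 * n) = seqA061162 n := by
  rw [seqA091527, ← realBinom_mul_pow_eq_seqA061162, pow_mul]
  push_cast
  rw [show 3 * (2 * (n : ℝ)) / 2 - 1 / 2 = 3 * n - 1 / 2 by ring]
  norm_num

theorem dilated_density_nonneg {x : ℝ} (hx : x ∈ Ioo (0 : ℝ) (6 * √3)) :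
    0 ≤ binomialDensity (3 / 2) (-(1 / 2)) (x / 4) / 4 :=
  div_nonneg (isPsiDensity_neg_half.binomialDensity_nonneg (dilated_mem_Ioo hx)) (by norm_num)

theorem dilated_density_moments (n : ℕ) :
    IntegrableOn (fun x => x ^ n * (binomialDensity (3 / 2) (-(1 / 2)) (x / 4) / 4))
      (Ioo 0 (6 * √3)) ∧
    ∫ x in Ioo 0 (6 * √3), x ^ n * (binomialDensity (3 / 2) (-(1 / 2)) (x / 4) / 4) =
      seqA091527 n := by
  have h := moments_dilate (g := binomialDensity (3 / 2) (-(1 / 2))) (zero_lt_four' ℝ) n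
    (isPsiDensity_neg_half.integrableOn_pow_mul_binomialDensity (by norm_num) (by norm_num) n)
  rw [isPsiDensity_neg_half.integral_pow_mul_binomialDensity (by norm_num) (by norm_num),
    show 4 * √(27 / 4) = 6 * √3 by rw [sqrt_27_div_4]; ring] at h
  refine ⟨h.1, h.2.trans ?_⟩
  rw [seqA091527, mul_comm]
  congr 2
  ring

theorem sqrt_mem_Ioo {x : ℝ} (hx : x ∈ Ioo (0 : ℝ) 108) : √x ∈ Ioo (0 : ℝ) (6 * √3) := by
  refine ⟨Real.sqrt_pos.2 hx.1, ?_⟩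
  rw [Real.sqrt_lt' (by positivity), mul_pow, Real.sq_sqrt (by norm_num)]
  linarith [hx.2]

theorem squared_density_moments (n : ℕ) :
    IntegrableOn
      (fun x => x ^ n * (binomialDensity (3 / 2) (-(1 / 2)) (√x / 4) / 4 / (2 * √x))) (Ioo 0 108) ∧
    ∫ x in Ioo 0 108, x ^ n * (binomialDensity (3 / 2) (-(1 / 2)) (√x / 4) / 4 / (2 * √x)) =
      seqA061162 n := by
  have hm := dilated_density_moments (2 * n)
  have h := moments_sq (g := fun x => binomialDensity (3 / 2) (-(1 / 2)) (x / 4) / 4)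
    (by positivity) n hm.1
  rw [hm.2, seqA091527_two_mul, mul_pow, Real.sq_sqrt (by norm_num),
    show (6 : ℝ) ^ 2 * 3 = 108 by norm_num] at h
  exact h

theorem squared_density_eq {x : ℝ} (hx : x ∈ Ioo (0 : ℝ) 108) :
    binomialDensity (3 / 2) (-(1 / 2)) (√x / 4) / 4 / (2 * √x) =
      (x ^ (2 / 3 : ℝ) +
          9 * (2 : ℝ) ^ (4 / 3 : ℝ) * (1 + √(1 - x / 108)) ^ (4 / 3 : ℝ)) /
        ((2 : ℝ) ^ (11 / 3 : ℝ) * (3 : ℝ) ^ (5 / 2 : ℝ) * Real.pi * x ^ (5 / 6 : ℝ) *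
          √(1 - x / 108) * (1 + √(1 - x / 108)) ^ (2 / 3 : ℝ)) := by
  have hx0 := hx.1
  have h2 : (2 : ℝ) ^ (11 / 3 : ℝ) = 2 ^ (8 / 3 : ℝ) * 2 := by
    rw [show (11 / 3 : ℝ) = 8 / 3 + 1 by norm_num, Real.rpow_add (by norm_num), Real.rpow_one]
  have h43 : √x ^ (4 / 3 : ℝ) = x ^ (2 / 3 : ℝ) := by
    rw [Real.sqrt_eq_rpow, ← Real.rpow_mul hx0.le]
    norm_num
  have h56 : x ^ (5 / 6 : ℝ) = √x ^ (2 / 3 : ℝ) * √x := by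
    rw [Real.sqrt_eq_rpow, ← Real.rpow_mul hx0.le, ← Real.rpow_add hx0]
    norm_num
  rw [binomialDensity_neg_half_dilated_eq (sqrt_mem_Ioo hx), Real.sq_sqrt hx0.le, h43, h56, h2,
    div_div]
  congr 1
  ring

/-! ### The main theorem -/

theorem theorem5p2 :
    -- existence of `V_{3/2,r}` as an inverse Mellin transform (along any admissible line), and
    -- `V_{3/2,r}(x) dx` is the one and only probability measure with moments `binom(3n/2+r, n)`
    (∀ r : ℝ, (r = -(1 / 2) ∨ r = 0 ∨ r = 1 / 2) →
      (∀ d : ℝ, 1 - (1 + r) / (3 / 2) < d → ∀ x ∈ Ioo (0 : ℝ) (√(27 / 4)),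
        Tendsto (fun T : ℝ => mellinInvTrunc (psiFun (3 / 2) r) d x T) atTop
          (𝓝 ((binomialDensity (3 / 2) r x : ℝ) : ℂ))) ∧
      (∀ x ∈ Ioo (0 : ℝ) (√(27 / 4)), 0 ≤ binomialDensity (3 / 2) r x) ∧
      (∀ ν : Measure ℝ,
        HasMomentSequence ν (fun n : ℕ => realBinom ((n : ℝ) * (3 / 2) + r) n) ↔
          ν = densityMeasure (binomialDensity (3 / 2) r) (√(27 / 4)))) ∧
    -- the explicit formulas
    (∀ x ∈ Ioo (0 : ℝ) (√(27 / 4)), ∀ z : ℝ, z = 4 * x ^ 2 / 27 →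
      binomialDensity (3 / 2) (-(1 / 2)) x =
          (1 + √(1 - z)) ^ (2 / 3 : ℝ) / (3 * Real.pi * √(3 * (1 - z))) * z ^ (-(1 / 3) : ℝ) +
          (1 + √(1 - z)) ^ (-(2 / 3) : ℝ) / (3 * Real.pi * √(3 * (1 - z))) * z ^ (1 / 3 : ℝ) ∧
      binomialDensity (3 / 2) 0 x =
          (1 + √(1 - z)) ^ (1 / 3 : ℝ) / (3 * Real.pi * √(1 - z)) * z ^ (-(1 / 6) : ℝ) +
          (1 + √(1 - z)) ^ (-(1 / 3) : ℝ) / (3 * Real.pi * √(1 - z)) * z ^ (1 / 6 : ℝ) ∧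
      binomialDensity (3 / 2) (1 / 2) x =
          (1 + √(1 - z)) ^ (1 / 3 : ℝ) / (Real.pi * √(3 * (1 - z))) * z ^ (1 / 3 : ℝ) +
          (1 + √(1 - z)) ^ (-(1 / 3) : ℝ) / (Real.pi * √(3 * (1 - z))) * z ^ (2 / 3 : ℝ)) ∧
    -- A091527 is the moment sequence of `V(x) = V_{3/2,-1/2}(x/4)/4` on `(0, 6√3)`
    (∀ ν : Measure ℝ, HasMomentSequence ν seqA091527 ↔
      ν = densityMeasure (fun x => binomialDensity (3 / 2) (-(1 / 2)) (x / 4) / 4) (6 * √3)) ∧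
    (∀ x ∈ Ioo (0 : ℝ) (6 * √3),
      binomialDensity (3 / 2) (-(1 / 2)) (x / 4) / 4 =
        (x ^ (4 / 3 : ℝ) +
            9 * (2 : ℝ) ^ (4 / 3 : ℝ) * (1 + √(1 - x ^ 2 / 108)) ^ (4 / 3 : ℝ)) /
          ((2 : ℝ) ^ (8 / 3 : ℝ) * (3 : ℝ) ^ (5 / 2 : ℝ) * Real.pi * x ^ (2 / 3 : ℝ) *
            √(1 - x ^ 2 / 108) * (1 + √(1 - x ^ 2 / 108)) ^ (2 / 3 : ℝ))) ∧
    -- A061162 is the even part of A091527 and the moment sequence of `V(√x)/(2√x)` on `(0, 108)`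
    (∀ n : ℕ, seqA091527 (2 * n) = seqA061162 n ∧
      realBinom (3 * (n : ℝ) - 1 / 2) (2 * n) * 16 ^ n = seqA061162 n) ∧
    (∀ ν : Measure ℝ, HasMomentSequence ν seqA061162 ↔
      ν = densityMeasure
        (fun x => binomialDensity (3 / 2) (-(1 / 2)) (√x / 4) / 4 / (2 * √x)) 108) ∧
    (∀ x ∈ Ioo (0 : ℝ) 108,
      binomialDensity (3 / 2) (-(1 / 2)) (√x / 4) / 4 / (2 * √x) =
        (x ^ (2 / 3 : ℝ) +
            9 * (2 : ℝ) ^ (4 / 3 : ℝ) * (1 + √(1 - x / 108)) ^ (4 / 3 : ℝ)) /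
          ((2 : ℝ) ^ (11 / 3 : ℝ) * (3 : ℝ) ^ (5 / 2 : ℝ) * Real.pi * x ^ (5 / 6 : ℝ) *
            √(1 - x / 108) * (1 + √(1 - x / 108)) ^ (2 / 3 : ℝ))) := by
  refine ⟨?_, fun x hx z hz => ⟨binomialDensity_neg_half_eq hx hz, binomialDensity_zero_eq hx hz,
      binomialDensity_half_eq hx hz⟩, ?_, fun x hx => binomialDensity_neg_half_dilated_eq hx,
    fun n => ⟨seqA091527_two_mul n, realBinom_mul_pow_eq_seqA061162 n⟩, ?_,
    fun x hx => squared_density_eq hx⟩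
  · intro r hr
    obtain ⟨V, hV⟩ : ∃ V, IsPsiDensity (3 / 2) r (√(27 / 4)) V := by
      rcases hr with rfl | rfl | rfl
      exacts [⟨_, isPsiDensity_neg_half⟩, ⟨_, isPsiDensity_zero⟩, ⟨_, isPsiDensity_half⟩]
    have hr1 : -1 < r := by rcases hr with rfl | rfl | rfl <;> norm_num
    refine ⟨fun d hd x hx => ?_, fun x hx => hV.binomialDensity_nonneg hx,
      hV.hasMomentSequence_iff (by norm_num) hr1⟩
    rw [hV.binomialDensity_eq hx]
    exact hV.tendsto hd hx
  · exact hasMomentSequence_iff_eq_densityMeasure (fun x hx => dilated_density_nonneg hx)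
      (fun n => (dilated_density_moments n).1) (fun n => (dilated_density_moments n).2)
      (by simp [seqA091527, realBinom_eq])
  · exact hasMomentSequence_iff_eq_densityMeasure
      (fun x hx => div_nonneg (dilated_density_nonneg (sqrt_mem_Ioo hx)) (by positivity))
      (fun n => (squared_density_moments n).1) (fun n => (squared_density_moments n).2)
      (by simp [seqA061162])
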